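/- Consider the message-passing model: there are $k\ge 2$ sites $P_1,\dots,P_k$, each with unbounded computational power, a local input and a random tape. They exchange point-to-point messages (nonempty bit strings, seen only by sender and recipient). The transcript specifies which site speaks next, when the protocol ends, and which site then reports the answer; what a site sends and to whom, and what it reports, depends only on its own input, its own tape and the messages it has sent or received. The tapes may have any joint distribution (so private and public coins are both covered). For a decision problem on a given set of inputs, $R^{\varepsilon}$ denotes the least $b$ such that some randomized protocol exchanges at most $b$ bits on every input and for all tapes and, on every single input, reports a wrong answer with probability at most $\varepsilon$. In the bipartiteness problem without edge duplication, site $P_i$ holds a simple graph $G_i$ on the vertex set $\{1,\dots,n\}$, no edge belongs to two different $G_i$, and the sites have to decide whether $G=G_1\cup\dots\cup G_k$ is bipartite. Put $r=\min\{n,m/k\}$. (a) There are absolute constants $C,c>0$ such that for all integers $n,m,k$ with $k\ge 2$, $C\log n\le k\le\min\{n,m\}$ and $m\ge n$, the problem on the inputs for which $G$ has at most $m$ edges satisfies $$R^{1/3}(\text{bipartiteness without edge duplication})\ \ge\ c\,\frac{kr}{\log k}.$$ (b) For every $\delta>0$ there are constants $C,c>0$ depending only on $\delta$ such that for all integers $n,m,k$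 with $k\ge 2$, $C\log n\le k\le\min\{n,m\}$ and $n\le m\le(\tfrac14-\delta)n^2$, the same bound $R^{1/3}\ge c\,kr/\log k$ holds even for the problem restricted to the inputs for which $G$ has exactly $m$ edges. -/

import Mathlib

open scoped ENNReal

namespace MessagePassing

/-- A point-to-point message: a bit string travelling from one of the `k` sites to another. -/
structure Message (k : ℕ) where
  sender : Fin k
  recipient : Fin k
  payload : List Bool

/-- The messages of an execution, in the order in which they were sent. -/
abbrev Transcript (k : ℕ) := List (Message k)

/-- The number of bits exchanged. -/
def Transcript.bits {k : ℕ} (t : Transcript k) : ℕ :=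
  (t.map fun e => e.payload.length).sum

/-- The part of the transcript that site `i` sees: the messages that it sent or received. -/
def Transcript.view {k : ℕ} (i : Fin k) (t : Transcript k) : Transcript k :=
  t.filter fun e => decide (e.sender = i ∨ e.recipient = i)

/-- A protocol for `k` sites in the message-passing model, where every site holds a local input
in `X` and a random tape in `T`. The transcript specifies which site speaks next (`none`: the
execution is over). The speaker chooses a recipient and a nonempty bit string, knowing only its
own input, its own tape and the messages it has itself sent or received. At the end one site,
specified by the transcript, reports an answer, again from its own input, tape and view. Sites
have unbounded computational power. -/
structure Protocol (k : ℕ) (X T : Type) where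
  speaker : Transcript k → Option (Fin k)
  recipient : Fin k → X → T → Transcript k → Fin k
  payload : Fin k → X → T → Transcript k → List Bool
  payload_ne_nil : ∀ i x ρ v, payload i x ρ v ≠ []
  reporter : Transcript k → Fin k
  answer : Fin k → X → T → Transcript k → Bool

namespace Protocol

variable {k : ℕ} {X T : Type}

/-- One step of the execution on inputs `x` and tapes `ρ` (no change once it is over). -/
def step (P : Protocol k X T) (x : Fin k → X) (ρ : Fin k → T) (t : Transcript k) :
    Transcript k :=
  match P.speaker t with
  | none => t
  | some i =>
      t ++ [{ sender := i
              recipient := P.recipient i (x i) (ρ i) (t.view i)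
              payload := P.payload i (x i) (ρ i) (t.view i) }]

/-- The execution on inputs `x` and tapes `ρ` ends, with final transcript `t`. -/
def HaltsWith (P : Protocol k X T) (x : Fin k → X) (ρ : Fin k → T) (t : Transcript k) : Prop :=
  P.speaker t = none ∧ ∃ s : ℕ, (P.step x ρ)^[s] [] = t

/-- The answer reported when the final transcript is `t`. -/
def report (P : Protocol k X T) (x : Fin k → X) (ρ : Fin k → T) (t : Transcript k) : Bool :=
  P.answer (P.reporter t) (x (P.reporter t)) (ρ (P.reporter t)) (t.view (P.reporter t))

/-- On all inputs from the domain and for all tapes, the execution ends with at most `b` bits. -/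
def CostAtMost (P : Protocol k X T) (dom : Set (Fin k → X)) (b : ℕ) : Prop :=
  ∀ x ∈ dom, ∀ ρ : Fin k → T, ∃ t, P.HaltsWith x ρ t ∧ t.bits ≤ b

/-- On every single input from the domain, the probability, over the tapes only, that the
protocol fails to report correctly whether `f` holds is at most `ε`. -/
def ComputesWithError (P : Protocol k X T) [MeasurableSpace T]
    (μ : MeasureTheory.Measure (Fin k → T)) (dom : Set (Fin k → X)) (f : (Fin k → X) → Prop)
    (ε : ℝ≥0∞) : Prop :=
  ∀ x ∈ dom, μ {ρ | ¬ ∃ t, P.HaltsWith x ρ t ∧ (P.report x ρ t = true ↔ f x)} ≤ ε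

end Protocol

/-- The randomized `ε`-error communication complexity of the decision problem `f` on the domain
`dom`: the least worst-case number of bits (over inputs in `dom` and tapes) of a randomized
protocol with error probability at most `ε` on every input in `dom`. The joint law `μ` of the
tapes of the `k` sites is arbitrary: independent tapes are private coins, and identical tapes
are public coins. -/
noncomputable def randomizedCC {k : ℕ} {X : Type} (ε : ℝ≥0∞) (dom : Set (Fin k → X))
    (f : (Fin k → X) → Prop) : ℝ≥0∞ :=
  ⨅ (b : ℕ) (_ : ∃ (T : Type) (_ : MeasurableSpace T)
      (μ : MeasureTheory.Measure (Fin k → T)) (_ : MeasureTheory.IsProbabilityMeasure μ)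
      (P : Protocol k X T), P.CostAtMost dom b ∧ P.ComputesWithError μ dom f ε), (b : ℝ≥0∞)

/-- The `k` sites hold graphs on the common vertex set `Fin n`; the input graph is their union. -/
def unionGraph {n k : ℕ} (G : Fin k → SimpleGraph (Fin n)) : SimpleGraph (Fin n) := ⨆ i, G i

/-- Inputs without edge duplication: no edge is held by two different sites. -/
def NoEdgeDuplication {n k : ℕ} (G : Fin k → SimpleGraph (Fin n)) : Prop :=
  ∀ i j, i ≠ j → Disjoint (G i).edgeSet (G j).edgeSet

/-- Inputs without edge duplication whose union has exactly `m` edges. -/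
def inputsExactly (n m k : ℕ) : Set (Fin k → SimpleGraph (Fin n)) :=
  {G | NoEdgeDuplication G ∧ (unionGraph G).edgeSet.ncard = m}

/-- Inputs without edge duplication whose union has at most `m` edges. -/
def inputsAtMost (n m k : ℕ) : Set (Fin k → SimpleGraph (Fin n)) :=
  {G | NoEdgeDuplication G ∧ (unionGraph G).edgeSet.ncard ≤ m}

/-- The bipartiteness problem: is the union of the local graphs bipartite? -/
def Bipartiteness {n k : ℕ} (G : Fin k → SimpleGraph (Fin n)) : Prop :=
  (unionGraph G).IsBipartite

end MessagePassing

/-! The bound comes from a disjointness problem. A hub holds a subset `U` of `r` elements, `k'`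
other sites hold subsets `S j`, and the question is whether some `S j` meets `U`. In the graph, the
hub vertex is joined to every site vertex, and a membership is an edge between a site and an
element. A common element closes a triangle through the hub; otherwise an explicit two-colouring
exists (`bipartiteness_gadgetGraph`). Filler edges stand for the non-memberships, so the number of
edges does not depend on the sets.

In the hard inputs the sets `S j` are independent given the hub's set and disjoint from it; in the
competing inputs a random site is made to share a random element with the hub. For fixed tapes, the
accepted inputs with a given view of site `j` form a rectangle between `S j` and all the rest
(`Protocol.HaltsWith.update`). A rectangle of mass ρ under the disjoint law has almost the same mass
under the meeting law: the relative loss is of order λ + log(1/ρ)/(λr), because a dense set in the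
cube correlates weakly with most coordinates (`sum_abs_cubeAvg_bitSign_le`, `rectangle_corruption`).

Weighting views by (8k²)^(-bits), which is summable by the Kraft bound `sum_pow_bits_le_two`,
replaces log(1/ρ) by log(8k²) times the number of bits that site `j` sees. A constant gap in
acceptance probability therefore forces an average site to see order r / log k bits. Each message is
seen by at most two sites, so summing over the sites gives order k'r / log k
(`Protocol.card_mul_le_of_disjointness`). -/

namespace MessagePassing

/-! ### Views of a transcript and the cut-and-paste property. -/

namespace Transcript

variable {k : ℕ}

theorem view_append (i : Fin k) (s t : Transcript k) :
    Transcript.view i (s ++ t) = Transcript.view i s ++ Transcript.view i t := by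
  simp [Transcript.view]

theorem view_singleton (i : Fin k) (e : Message k) :
    Transcript.view i [e] = if e.sender = i ∨ e.recipient = i then [e] else [] := by
  by_cases h : e.sender = i ∨ e.recipient = i <;> simp [Transcript.view, h]

/-- Every message is seen by at most two sites. -/
theorem sum_bits_view_le {ι : Type*} [Fintype ι] (emb : ι ↪ Fin k) (t : Transcript k) :
    ∑ j, Transcript.bits (Transcript.view (emb j) t) ≤ 2 * Transcript.bits t := by
  classical
  induction t with
  | nil => simp [Transcript.view, Transcript.bits]
  | cons e t ih =>
    have h1 : ∀ j, Transcript.bits (Transcript.view (emb j) (e :: t)) ≤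
        ((if emb j = e.sender then e.payload.length else 0) +
          (if emb j = e.recipient then e.payload.length else 0)) +
          Transcript.bits (Transcript.view (emb j) t) := by
      intro j
      simp only [Transcript.view, Transcript.bits, List.filter_cons, decide_eq_true_eq]
      by_cases h : e.sender = emb j <;> by_cases h' : e.recipient = emb j <;>
        simp [h, h', eq_comm]
    have h2 : ∀ a : Fin k, ∑ j, (if emb j = a then e.payload.length else 0) ≤
        e.payload.length := by
      intro a
      rw [← Finset.sum_filter, Finset.sum_const, smul_eq_mul]
      have : (Finset.univ.filter fun j => emb j = a).card ≤ 1 := by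
        rw [Finset.card_le_one]
        intro x hx y hy
        simp only [Finset.mem_filter, Finset.mem_univ, true_and] at hx hy
        exact emb.injective (hx.trans hy.symm)
      nlinarith
    have h3 : Transcript.bits (e :: t) = e.payload.length + Transcript.bits t := by
      simp [Transcript.bits]
    calc _ ≤ ∑ j, _ := Finset.sum_le_sum fun j _ => h1 j
      _ ≤ _ := by
        rw [Finset.sum_add_distrib, Finset.sum_add_distrib]
        have := h2 e.sender
        have := h2 e.recipient
        omega

end Transcript

namespace Protocol

variable {k : ℕ} {X T : Type} (P : Protocol k X T)

/-- The messages sent by site `i` in the view `v` are those that it sends on the local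
input `a` and the tape `ρ`. -/
def Consistent (i : Fin k) (a : X) (ρ : T) (v : Transcript k) : Prop :=
  ∀ v₁ e v₂, v = v₁ ++ e :: v₂ → e.sender = i →
    e.recipient = P.recipient i a ρ v₁ ∧ e.payload = P.payload i a ρ v₁

variable {P}

theorem Consistent.of_append {i : Fin k} {a : X} {ρ : T} {v w : Transcript k}
    (h : P.Consistent i a ρ (v ++ w)) : P.Consistent i a ρ v := by
  intro v₁ e v₂ hv he
  exact h v₁ e (v₂ ++ w) (by simp [hv]) he

theorem Consistent.concat {i : Fin k} {a : X} {ρ : T} {v : Transcript k} {e : Message k}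
    (h : P.Consistent i a ρ v)
    (he : e.sender = i → e.recipient = P.recipient i a ρ v ∧ e.payload = P.payload i a ρ v) :
    P.Consistent i a ρ (v ++ [e]) := by
  intro v₁ f v₂ hv hf
  rcases List.eq_nil_or_concat' v₂ with rfl | ⟨v₃, e', rfl⟩
  · obtain ⟨rfl, hv2⟩ := List.append_inj' hv rfl
    simp only [List.cons.injEq, and_true] at hv2
    subst hv2
    exact he hf
  · have hv' : v ++ [e] = (v₁ ++ f :: v₃) ++ [e'] := hv.trans (by simp)
    exact h v₁ f v₃ (List.append_inj' hv' rfl).1 hf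

variable (P)

theorem step_of_speaker_none {x : Fin k → X} {ρ : Fin k → T} {t : Transcript k}
    (h : P.speaker t = none) : P.step x ρ t = t := by
  simp [step, h]

theorem step_of_speaker_some {x : Fin k → X} {ρ : Fin k → T} {t : Transcript k} {i : Fin k}
    (h : P.speaker t = some i) :
    P.step x ρ t = t ++ [⟨i, P.recipient i (x i) (ρ i) (t.view i),
      P.payload i (x i) (ρ i) (t.view i)⟩] := by
  simp [step, h]

theorem exists_iterate_step_eq_append (x : Fin k → X) (ρ : Fin k → T) (s d : ℕ) :
    ∃ u, (P.step x ρ)^[s + d] [] = (P.step x ρ)^[s] [] ++ u := by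
  induction d with
  | zero => exact ⟨[], by simp⟩
  | succ d ih =>
    obtain ⟨u, hu⟩ := ih
    rw [← add_assoc, Function.iterate_succ_apply', hu]
    cases h : P.speaker ((P.step x ρ)^[s] [] ++ u) with
    | none => exact ⟨u, by rw [P.step_of_speaker_none h]⟩
    | some i => exact ⟨_, by rw [P.step_of_speaker_some h, List.append_assoc]⟩

theorem payload_ne_nil_of_mem_iterate (x : Fin k → X) (ρ : Fin k → T) (s : ℕ) :
    ∀ e ∈ (P.step x ρ)^[s] [], e.payload ≠ [] := by
  induction s with
  | zero => simp
  | succ s ih =>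
    rw [Function.iterate_succ_apply']
    cases h : P.speaker ((P.step x ρ)^[s] []) with
    | none => rwa [P.step_of_speaker_none h]
    | some i =>
      rw [P.step_of_speaker_some h]
      intro e he
      rcases List.mem_append.1 he with he | he
      · exact ih e he
      · rw [List.mem_singleton.1 he]
        exact P.payload_ne_nil _ _ _ _

theorem consistent_iterate (x : Fin k → X) (ρ : Fin k → T) (i : Fin k) (s : ℕ) :
    P.Consistent i (x i) (ρ i) (Transcript.view i ((P.step x ρ)^[s] [])) := by
  induction s with
  | zero =>
    intro v₁ e v₂ hv
    simp [Transcript.view] at hv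
  | succ s ih =>
    rw [Function.iterate_succ_apply']
    cases h : P.speaker ((P.step x ρ)^[s] []) with
    | none => rwa [P.step_of_speaker_none h]
    | some l =>
      rw [P.step_of_speaker_some h, Transcript.view_append, Transcript.view_singleton]
      split_ifs
      · refine ih.concat ?_
        rintro rfl
        exact ⟨rfl, rfl⟩
      · rwa [List.append_nil]

/-- By induction on the steps: the other speakers do not see the new input, and when site `i`
speaks, consistency says that `a` makes it send the very message already in the transcript. -/
theorem iterate_update_of_consistent [DecidableEq (Fin k)] (x : Fin k → X) (ρ : Fin k → T)
    (i : Fin k) (a : X) (s : ℕ)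
    (h : P.Consistent i a (ρ i) (Transcript.view i ((P.step x ρ)^[s] []))) :
    (P.step (Function.update x i a) ρ)^[s] [] = (P.step x ρ)^[s] [] := by
  induction s with
  | zero => rfl
  | succ s ih =>
    have hpre : P.Consistent i a (ρ i) (Transcript.view i ((P.step x ρ)^[s] [])) := by
      obtain ⟨u, hu⟩ := P.exists_iterate_step_eq_append x ρ s 1
      rw [hu, Transcript.view_append] at h
      exact h.of_append
    rw [Function.iterate_succ_apply', Function.iterate_succ_apply', ih hpre]
    rw [Function.iterate_succ_apply'] at h
    set t := (P.step x ρ)^[s] [] with ht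
    cases hs : P.speaker t with
    | none => rw [P.step_of_speaker_none hs, P.step_of_speaker_none hs]
    | some l =>
      rw [P.step_of_speaker_some hs, P.step_of_speaker_some hs]
      by_cases hl : l = i
      · subst hl
        rw [P.step_of_speaker_some hs, Transcript.view_append, Transcript.view_singleton,
          if_pos (Or.inl rfl)] at h
        have := h (Transcript.view l t) _ [] rfl rfl
        simp only [Function.update_self]
        rw [← this.1, ← this.2]
      · simp only [Function.update_of_ne hl]

theorem HaltsWith.unique {P : Protocol k X T} {x : Fin k → X} {ρ : Fin k → T}
    {t t' : Transcript k} (h : P.HaltsWith x ρ t) (h' : P.HaltsWith x ρ t') : t = t' := by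
  have key : ∀ (s d : ℕ), P.speaker ((P.step x ρ)^[s] []) = none →
      (P.step x ρ)^[s + d] [] = (P.step x ρ)^[s] [] := by
    intro s d hs
    induction d with
    | zero => rfl
    | succ d ih => rw [← add_assoc, Function.iterate_succ_apply', ih, P.step_of_speaker_none hs]
  obtain ⟨h1, s, hs⟩ := h
  obtain ⟨h1', s', hs'⟩ := h'
  subst hs hs'
  rcases le_total s s' with hle | hle
  · obtain ⟨d, rfl⟩ := Nat.exists_eq_add_of_le hle
    exact (key s d h1).symm
  · obtain ⟨d, rfl⟩ := Nat.exists_eq_add_of_le hle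
    exact key s' d h1'

theorem HaltsWith.payload_ne_nil {P : Protocol k X T} {x : Fin k → X} {ρ : Fin k → T}
    {t : Transcript k} (h : P.HaltsWith x ρ t) : ∀ e ∈ t, e.payload ≠ [] := by
  obtain ⟨_, s, rfl⟩ := h
  exact P.payload_ne_nil_of_mem_iterate x ρ s

/-- Cut and paste: if site `i` has the same view on two inputs, then exchanging its local input
does not change the transcript. -/
theorem HaltsWith.update {P : Protocol k X T} [DecidableEq (Fin k)] {x x' : Fin k → X}
    {ρ : Fin k → T} {t t' : Transcript k}
    (h : P.HaltsWith x ρ t) (h' : P.HaltsWith x' ρ t') {i : Fin k}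
    (hv : Transcript.view i t = Transcript.view i t') :
    P.HaltsWith (Function.update x i (x' i)) ρ t := by
  obtain ⟨h1, s, rfl⟩ := h
  obtain ⟨_, s', rfl⟩ := h'
  -- The view of `i` is also its view in the run on `x'`, hence it is consistent with `x' i`.
  refine ⟨h1, s, P.iterate_update_of_consistent x ρ i (x' i) s ?_⟩
  rw [hv]
  exact P.consistent_iterate x' ρ i s'

end Protocol

/-! ### A Kraft inequality for transcripts. -/

section Kraft

theorem tsum_pi_prod_eq_pow {α : Type*} (w : α → ℝ≥0∞) (n : ℕ) :
    ∑' f : Fin n → α, ∏ i, w (f i) = (∑' a, w a) ^ n := by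
  induction n with
  | zero => simp
  | succ n ih =>
    rw [← (Fin.consEquiv fun _ => α).tsum_eq, ENNReal.tsum_prod', pow_succ', ← ih,
      ← ENNReal.tsum_mul_right]
    refine tsum_congr fun a => ?_
    rw [← ENNReal.tsum_mul_left]
    refine tsum_congr fun f => ?_
    rw [Fin.prod_univ_succ]
    simp [Fin.consEquiv]

/-- Grouping lists by length turns the sum into a geometric series of ratio at most 1/2. -/
theorem tsum_list_prod_le_two {α : Type*} (w : α → ℝ≥0∞) (hw : ∑' a, w a ≤ 2⁻¹) :
    ∑' l : List α, (l.map w).prod ≤ 2 := by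
  rw [← (List.equivSigmaTuple (α := α)).symm.tsum_eq, ENNReal.tsum_sigma']
  have : ∀ n : ℕ, ∑' f : Fin n → α, ((List.equivSigmaTuple.symm ⟨n, f⟩ : List α).map w).prod =
      (∑' a, w a) ^ n := by
    intro n
    rw [← tsum_pi_prod_eq_pow]
    refine tsum_congr fun f => ?_
    simp [List.equivSigmaTuple, List.prod_ofFn, List.map_ofFn]
  simp_rw [this]
  rw [ENNReal.tsum_geometric]
  calc (1 - ∑' a, w a)⁻¹ ≤ (1 - 2⁻¹)⁻¹ := ENNReal.inv_le_inv.2 (tsub_le_tsub_left hw 1)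
    _ = 2 := by rw [ENNReal.one_sub_inv_two, inv_inv]

/-- The first bit contributes 2θ and the remaining, possibly empty, string at most 2. -/
theorem tsum_nonempty_pow_length_le (θ : ℝ≥0∞) (hθ : 2 * θ ≤ 2⁻¹) :
    ∑' l : List Bool, (if l = [] then 0 else θ ^ l.length) ≤ 4 * θ := by
  have h1 : ∑' l : List Bool, θ ^ l.length ≤ 2 := by
    have := tsum_list_prod_le_two (fun _ : Bool => θ) (by simpa [two_mul] using hθ)
    simpa using this
  have hinj : Function.Injective fun p : Bool × List Bool => p.1 :: p.2 := by
    rintro ⟨a, l⟩ ⟨b, l'⟩ h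
    simpa using h
  rw [← hinj.tsum_eq]
  · rw [ENNReal.tsum_prod']
    simp only [reduceCtorEq, if_false, List.length_cons, pow_succ, ENNReal.tsum_mul_right,
      tsum_fintype, Fintype.univ_bool, Finset.sum_const]
    calc _ = 2 * ((∑' l : List Bool, θ ^ l.length) * θ) := by simp [two_mul]
      _ ≤ 2 * (2 * θ) := by gcongr
      _ = 4 * θ := by rw [← mul_assoc]; norm_num
  · intro l hl
    cases l with
    | nil => simp at hl
    | cons a l => exact ⟨(a, l), rfl⟩

/-- A Kraft inequality for transcripts with nonempty messages. -/
theorem sum_pow_bits_le_two {k : ℕ} (hk : 1 ≤ k) (F : Finset (Transcript k))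
    (hF : ∀ t ∈ F, ∀ e ∈ t, e.payload ≠ []) :
    ∑ t ∈ F, (1 / (8 * (k : ℝ) ^ 2)) ^ t.bits ≤ 2 := by
  have hk' : (1 : ℝ) ≤ k := by exact_mod_cast hk
  have hpos : (0 : ℝ) ≤ 1 / (8 * (k : ℝ) ^ 2) := by positivity
  -- There are k² pairs of sender and recipient, each of weight at most 4θ, so single messages have
  -- total weight at most 1/2. Nonempty payloads are essential: the addresses are paid for by the
  -- bits.
  set θ : ℝ≥0∞ := ENNReal.ofReal (1 / (8 * (k : ℝ) ^ 2)) with hθ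
  have hθ2 : 2 * θ ≤ 2⁻¹ := by
    have e1 : (2 : ℝ≥0∞) = ENNReal.ofReal 2 := by simp
    rw [hθ, e1, ← ENNReal.ofReal_inv_of_pos two_pos, ← ENNReal.ofReal_mul zero_le_two]
    apply ENNReal.ofReal_le_ofReal
    rw [mul_one_div, div_le_iff₀ (by positivity)]
    nlinarith
  let w : Message k → ℝ≥0∞ := fun e => if e.payload = [] then 0 else θ ^ e.payload.length
  have hw : ∑' e, w e ≤ 2⁻¹ := by
    let eq : Fin k × Fin k × List Bool ≃ Message k :=
      { toFun := fun p => ⟨p.1, p.2.1, p.2.2⟩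
        invFun := fun e => (e.sender, e.recipient, e.payload)
        left_inv := fun _ => rfl
        right_inv := fun _ => rfl }
    rw [← eq.tsum_eq, ENNReal.tsum_prod']
    simp_rw [ENNReal.tsum_prod']
    calc _ ≤ ∑' _ : Fin k, ∑' _ : Fin k, 4 * θ :=
          ENNReal.tsum_le_tsum fun _ => ENNReal.tsum_le_tsum fun _ =>
            tsum_nonempty_pow_length_le θ hθ2
      _ = ENNReal.ofReal (k * (k * (4 * (1 / (8 * (k : ℝ) ^ 2))))) := by
          rw [ENNReal.ofReal_mul (by positivity), ENNReal.ofReal_mul (by positivity),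
            ENNReal.ofReal_mul (by positivity), ← hθ]
          simp [tsum_fintype]
      _ = ENNReal.ofReal 2⁻¹ := by
          congr 1
          field_simp
          norm_num
      _ = 2⁻¹ := by rw [ENNReal.ofReal_inv_of_pos two_pos]; simp
  have hbits : ∀ t ∈ F, (t.map w).prod = θ ^ t.bits := by
    intro t ht
    have h := hF t ht
    clear ht
    induction t with
    | nil => simp [Transcript.bits]
    | cons e t ih =>
      rw [List.map_cons, List.prod_cons, ih fun e he => h e (List.mem_cons_of_mem _ he)]
      simp [w, h e (List.mem_cons_self), Transcript.bits, pow_add]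
  have key : ∑ t ∈ F, θ ^ t.bits ≤ 2 := by
    rw [← Finset.sum_congr rfl hbits]
    exact (ENNReal.sum_le_tsum F).trans (tsum_list_prod_le_two w hw)
  rw [← ENNReal.ofReal_le_ofReal_iff zero_le_two,
    ENNReal.ofReal_sum_of_nonneg fun t _ => pow_nonneg hpos _]
  simp_rw [ENNReal.ofReal_pow hpos, ← hθ]
  simpa using key

end Kraft

end MessagePassing

/-! ### Functions on the cube and the corruption of rectangles. -/

section Cube

variable {r : ℕ}

/-- Resampling one coordinate of a family of independent random variables with law `W`. -/
theorem sum_prod_resample {ι α : Type*} [Fintype ι] [DecidableEq ι] [Fintype α]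
    (W : α → ℝ) (hW : ∑ a, W a = 1) (j : ι) (F : (ι → α) → ℝ) :
    ∑ S : ι → α, (∏ l, W (S l)) * ∑ a, W a * F (Function.update S j a) =
      ∑ S : ι → α, (∏ l, W (S l)) * F S := by
  -- Exchanging coordinate `j` with the fresh sample is an involution that preserves the product
  -- weight.
  have hinv : Function.Involutive fun p : (ι → α) × α => (Function.update p.1 j p.2, p.1 j) := by
    rintro ⟨S, a⟩
    simp
  have hprod : ∀ (S : ι → α) (a : α),
      (∏ l, W (Function.update S j a l)) * W (S j) = (∏ l, W (S l)) * W a := by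
    intro S a
    rw [← Finset.mul_prod_erase Finset.univ _ (Finset.mem_univ j),
      ← Finset.mul_prod_erase Finset.univ (fun l => W (S l)) (Finset.mem_univ j),
      Finset.prod_congr rfl (g := fun l => W (S l)) fun l hl => by
        rw [Function.update_of_ne (Finset.ne_of_mem_erase hl)]]
    rw [Function.update_self]
    ring
  calc _ = ∑ p : (ι → α) × α, (∏ l, W (p.1 l)) * W p.2 * F (Function.update p.1 j p.2) := by
        rw [Fintype.sum_prod_type]
        simp only [Finset.mul_sum, mul_assoc]
    _ = ∑ p : (ι → α) × α, (∏ l, W (p.1 l)) * W p.2 * F p.1 := by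
        rw [← Equiv.sum_comp hinv.toPerm]
        refine Finset.sum_congr rfl fun p _ => ?_
        simp [Function.Involutive.toPerm, hprod]
    _ = _ := by
        rw [Fintype.sum_prod_type]
        refine Finset.sum_congr rfl fun S _ => ?_
        simp only
        rw [← Finset.sum_mul, ← Finset.mul_sum, hW, mul_one]

/-- The average of a function on the cube. -/
noncomputable def cubeAvg (F : (Fin r → Bool) → ℝ) : ℝ := (∑ X, F X) / 2 ^ r

theorem cubeAvg_mono {F G : (Fin r → Bool) → ℝ} (h : ∀ X, F X ≤ G X) : cubeAvg F ≤ cubeAvg G := by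
  unfold cubeAvg
  gcongr with X
  exact h X

theorem cubeAvg_nonneg {F : (Fin r → Bool) → ℝ} (h : ∀ X, 0 ≤ F X) : 0 ≤ cubeAvg F :=
  div_nonneg (Finset.sum_nonneg fun X _ => h X) (by positivity)

theorem cubeAvg_const (a : ℝ) : cubeAvg (fun _ : Fin r → Bool => a) = a := by
  simp [cubeAvg]

theorem cubeAvg_add (F G : (Fin r → Bool) → ℝ) :
    cubeAvg (fun X => F X + G X) = cubeAvg F + cubeAvg G := by
  simp [cubeAvg, Finset.sum_add_distrib, add_div]

theorem cubeAvg_sub (F G : (Fin r → Bool) → ℝ) :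
    cubeAvg (fun X => F X - G X) = cubeAvg F - cubeAvg G := by
  simp [cubeAvg, Finset.sum_sub_distrib, sub_div]

theorem cubeAvg_mul_left (a : ℝ) (F : (Fin r → Bool) → ℝ) :
    cubeAvg (fun X => a * F X) = a * cubeAvg F := by
  simp [cubeAvg, ← Finset.mul_sum, mul_div_assoc]

theorem cubeAvg_mul_right (a : ℝ) (F : (Fin r → Bool) → ℝ) :
    cubeAvg (fun X => F X * a) = cubeAvg F * a := by
  simp only [mul_comm _ a, cubeAvg_mul_left]

theorem cubeAvg_sum {ι : Type*} (s : Finset ι) (F : ι → (Fin r → Bool) → ℝ) :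
    cubeAvg (fun X => ∑ i ∈ s, F i X) = ∑ i ∈ s, cubeAvg (F i) := by
  simp only [cubeAvg, ← Finset.sum_div]
  rw [Finset.sum_comm]

theorem cubeAvg_eq_avg_update (e : Fin r) (F : (Fin r → Bool) → ℝ) :
    cubeAvg F = cubeAvg fun X =>
      (F (Function.update X e false) + F (Function.update X e true)) / 2 := by
  have h := sum_prod_resample (ι := Fin r) (fun _ : Bool => (1 / 2 : ℝ)) (by norm_num) e F
  simp only [Fintype.sum_bool, Finset.prod_const, ← Finset.mul_sum] at h
  have h2 := mul_left_cancel₀ (by positivity) h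
  unfold cubeAvg
  rw [← h2, Finset.mul_sum]
  refine congrArg (· / _) (Finset.sum_congr rfl fun X _ => ?_)
  ring

/-- The sign of a bit. -/
def bitSign (b : Bool) : ℝ := if b then -1 else 1

/-- Hoeffding's bound: the average factors over the coordinates into hyperbolic cosines. -/
theorem cubeAvg_exp_le (σ : Fin r → ℝ) (lam : ℝ) (hσ : ∀ e, |σ e| ≤ 1) :
    cubeAvg (fun X => Real.exp (lam * ∑ e, σ e * bitSign (X e))) ≤
      Real.exp (lam ^ 2 * r / 2) := by
  have h1 : ∑ X : Fin r → Bool, Real.exp (lam * ∑ e, σ e * bitSign (X e)) =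
      ∏ e, (2 * Real.cosh (lam * σ e)) := by
    have : ∀ e, 2 * Real.cosh (lam * σ e) = ∑ b : Bool, Real.exp (lam * (σ e * bitSign b)) := by
      intro e
      simp [Real.cosh_eq, bitSign]
      ring
    simp_rw [this]
    rw [Fintype.prod_sum]
    refine Finset.sum_congr rfl fun X _ => ?_
    rw [Finset.mul_sum, Real.exp_sum]
  have h2 : ∏ e : Fin r, Real.cosh (lam * σ e) ≤ ∏ _e : Fin r, Real.exp (lam ^ 2 / 2) := by
    refine Finset.prod_le_prod (fun e _ => (Real.cosh_pos _).le) fun e _ => ?_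
    refine (Real.cosh_le_exp_half_sq _).trans (Real.exp_le_exp.2 ?_)
    have := sq_le_one_iff_abs_le_one _ |>.2 (hσ e)
    nlinarith [sq_nonneg lam]
  unfold cubeAvg
  rw [h1, Finset.prod_mul_distrib, Finset.prod_const, Finset.card_univ, Fintype.card_fin,
    mul_div_cancel_left₀ _ (by positivity)]
  refine h2.trans_eq ?_
  rw [Finset.prod_const, Finset.card_univ, Fintype.card_fin, ← Real.exp_nat_mul]
  ring_nf

/-- A level-one inequality: a function on the cube with values in `[0, 1]` and large mean has
small correlation with most of the coordinates. -/
theorem sum_abs_cubeAvg_bitSign_le (w : (Fin r → Bool) → ℝ) (h0 : ∀ X, 0 ≤ w X)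
    (h1 : ∀ X, w X ≤ 1) {lam : ℝ} :
    lam * ∑ e, |cubeAvg fun X => bitSign (X e) * w X| ≤
      cubeAvg w * (lam ^ 2 * r / 2 - Real.log (cubeAvg w)) := by
  rcases (cubeAvg_nonneg h0).eq_or_lt with hF | hF
  · have hw : ∀ X, w X = 0 := by
      have : ∑ X, w X = 0 := by
        have := (div_eq_zero_iff.1 (hF.symm : (∑ X, w X) / 2 ^ r = 0))
        exact this.resolve_right (by positivity)
      intro X
      exact (Finset.sum_eq_zero_iff_of_nonneg fun X _ => h0 X).1 this X (Finset.mem_univ X)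
    simp [hw, cubeAvg]
  set F := cubeAvg w with hFdef
  set σ : Fin r → ℝ := fun e => SignType.sign (cubeAvg fun X => bitSign (X e) * w X) with hσ
  have hσ1 : ∀ e, |σ e| ≤ 1 := by
    intro e
    simp only [hσ]
    rcases SignType.sign (cubeAvg fun X => bitSign (X e) * w X) with _ | _ | _ <;> simp
  -- This value makes exp(-c) times the exponential moment bound equal to `F`, which cancels the
  -- average of the `+ w X` in `e2`.
  set c := lam ^ 2 * r / 2 - Real.log F with hc
  have e1 : ∑ e, |cubeAvg fun X => bitSign (X e) * w X| =
      cubeAvg fun X => w X * ∑ e, σ e * bitSign (X e) := by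
    simp_rw [Finset.mul_sum]
    rw [cubeAvg_sum]
    refine Finset.sum_congr rfl fun e _ => ?_
    rw [← sign_mul_self, ← cubeAvg_mul_left]
    congr 1
    ext X
    ring
  have e2 : ∀ X, lam * (w X * ∑ e, σ e * bitSign (X e)) - c * w X + w X ≤
      Real.exp (-c) * Real.exp (lam * ∑ e, σ e * bitSign (X e)) := by
    intro X
    set y := lam * ∑ e, σ e * bitSign (X e) with hy
    have h3 := Real.add_one_le_exp (y - c)
    have h4 : w X * (y - c + 1) ≤ Real.exp (y - c) :=
      (mul_le_mul_of_nonneg_left h3 (h0 X)).trans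
        (mul_le_of_le_one_left (Real.exp_pos _).le (h1 X))
    rw [← Real.exp_add, show -c + y = y - c by ring]
    calc _ = w X * (y - c + 1) := by rw [hy]; ring
      _ ≤ _ := h4
  have e3 := (cubeAvg_mono e2).trans_eq (cubeAvg_mul_left _ _)
  rw [cubeAvg_add, cubeAvg_sub, cubeAvg_mul_left, cubeAvg_mul_left, ← e1, ← hFdef] at e3
  have e4 := mul_le_mul_of_nonneg_left (cubeAvg_exp_le σ lam hσ1) (Real.exp_pos (-c)).le
  rw [← Real.exp_add, hc, show -(lam ^ 2 * r / 2 - Real.log F) + lam ^ 2 * r / 2 = Real.log F by ring,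
    Real.exp_log hF] at e4
  linarith

/-- The coordinates of `X` in `z`; the others are set to zero. -/
def maskOn (z X : Fin r → Bool) : Fin r → Bool := fun e => z e && X e

/-- The coordinates of `X` outside `z`; the others are set to zero. -/
def maskOff (z X : Fin r → Bool) : Fin r → Bool := fun e => !z e && X e

theorem maskOff_eq (z X : Fin r → Bool) : maskOff z X = maskOn (fun e => !z e) X := rfl

theorem update_maskOn_update_left (z X : Fin r → Bool) (e : Fin r) (a b : Bool) :
    Function.update (maskOn (Function.update z e b) X) e a = Function.update (maskOn z X) e a := by
  ext l
  by_cases h : l = e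
  · subst h; simp
  · simp [h, maskOn]

theorem maskOn_update_right (z X : Fin r → Bool) (e : Fin r) (a : Bool) (hz : z e = true) :
    maskOn z (Function.update X e a) = Function.update (maskOn z X) e a := by
  ext l
  by_cases h : l = e
  · subst h; simp [maskOn, hz]
  · simp [h, maskOn]

theorem maskOn_eq_update (z X : Fin r → Bool) (e : Fin r) (hz : z e = false) :
    maskOn z X = Function.update (maskOn z X) e false := by
  ext l
  by_cases h : l = e
  · subst h; simp [maskOn, hz]
  · simp [h]

/-- The average of `f` over the sets inside `z`, with the coordinate `e` set to `a`. -/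
noncomputable def condAvg (f : (Fin r → Bool) → ℝ) (e : Fin r) (a : Bool) (z : Fin r → Bool) : ℝ :=
  cubeAvg fun X => f (Function.update (maskOn z X) e a)

/-- Once coordinate `e` is overwritten, the side on which `z` puts `e` is irrelevant. Hence the same
four conditional averages describe both values of `z e`. -/
theorem condAvg_update (f : (Fin r → Bool) → ℝ) (e : Fin r) (a b : Bool) (z : Fin r → Bool) :
    condAvg f e a (Function.update z e b) = condAvg f e a z := by
  simp only [condAvg, update_maskOn_update_left]

theorem cubeAvg_maskOn_of_true (f : (Fin r → Bool) → ℝ) (e : Fin r) (z : Fin r → Bool)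
    (hz : z e = true) :
    cubeAvg (fun X => f (maskOn z X)) = (condAvg f e false z + condAvg f e true z) / 2 := by
  rw [cubeAvg_eq_avg_update e]
  simp only [maskOn_update_right _ _ _ _ hz, condAvg]
  rw [← cubeAvg_add, div_eq_mul_inv, ← cubeAvg_mul_right]
  rfl

theorem cubeAvg_bitSign_maskOn_of_true (f : (Fin r → Bool) → ℝ) (e : Fin r) (z : Fin r → Bool)
    (hz : z e = true) :
    cubeAvg (fun X => bitSign (X e) * f (maskOn z X)) =
      (condAvg f e false z - condAvg f e true z) / 2 := by
  rw [cubeAvg_eq_avg_update e]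
  simp only [maskOn_update_right _ _ _ _ hz, condAvg]
  rw [← cubeAvg_sub, div_eq_mul_inv, ← cubeAvg_mul_right]
  congr 1
  ext X
  simp [bitSign]
  ring

theorem cubeAvg_maskOn_of_false (f : (Fin r → Bool) → ℝ) (e : Fin r) (z : Fin r → Bool)
    (hz : z e = false) :
    cubeAvg (fun X => f (maskOn z X)) = condAvg f e false z := by
  unfold condAvg
  congr 1
  ext X
  rw [← maskOn_eq_update z X e hz]

theorem condAvg_nonneg {f : (Fin r → Bool) → ℝ} (h0 : ∀ X, 0 ≤ f X) (e : Fin r) (a : Bool)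
    (z : Fin r → Bool) : 0 ≤ condAvg f e a z := cubeAvg_nonneg fun _ => h0 _

/-- The left side vanishes when f₀ = f₁ and g₀ = g₁, so the differences control it. Once their signs
are fixed, the inequality is bilinear in nonnegative numbers. -/
theorem four_point_inequality {f₀ f₁ g₀ g₁ : ℝ} (hf₀ : 0 ≤ f₀) (hf₁ : 0 ≤ f₁) (hg₀ : 0 ≤ g₀)
    (hg₁ : 0 ≤ g₁) :
    (f₀ + f₁) / 2 * g₀ + f₀ * ((g₀ + g₁) / 2) - 2 * (f₁ * g₁) ≤
      10 * (|(f₀ - f₁) / 2| * g₀ + f₀ * |(g₀ - g₁) / 2|) := by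
  have ha : |(f₀ - f₁) / 2| = |f₀ - f₁| / 2 := by rw [abs_div]; norm_num
  have hb : |(g₀ - g₁) / 2| = |g₀ - g₁| / 2 := by rw [abs_div]; norm_num
  rw [ha, hb]
  rcases abs_cases (f₀ - f₁) with ⟨h1, h1'⟩ | ⟨h1, h1'⟩ <;>
    rcases abs_cases (g₀ - g₁) with ⟨h2, h2'⟩ | ⟨h2, h2'⟩ <;> rw [h1, h2] <;>
    nlinarith [mul_nonneg hf₀ hg₀, mul_nonneg hf₁ hg₁, mul_nonneg hf₀ hg₁, mul_nonneg hf₁ hg₀]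

/-- Corruption of a single rectangle `f × g` of sets: compare the disjoint pairs with the pairs
that meet in the element `e`. -/
theorem rectangle_corruption_coord (f g : (Fin r → Bool) → ℝ) (hf : ∀ X, 0 ≤ f X)
    (hg : ∀ X, 0 ≤ g X) (e : Fin r) :
    cubeAvg (fun z => cubeAvg (fun X => f (maskOn z X)) * cubeAvg fun Y => g (maskOff z Y)) -
      cubeAvg (fun z => cubeAvg (fun X => f (Function.update (maskOn z X) e true)) *
        cubeAvg fun Y => g (Function.update (maskOff z Y) e true)) ≤
    10 * cubeAvg fun z =>
      |cubeAvg fun X => bitSign (X e) * f (maskOn z X)| * cubeAvg (fun Y => g (maskOff z Y)) +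
      cubeAvg (fun X => f (maskOn z X)) * |cubeAvg fun Y => bitSign (Y e) * g (maskOff z Y)| := by
  -- Both values of `z e` are averaged first. The disjoint pair contributes (f₀+f₁)/2·g₀ or
  -- f₀·(g₀+g₁)/2 according to the side of `e`; the meeting pair contributes f₁g₁ either way.
  rw [← cubeAvg_sub, ← cubeAvg_mul_left, cubeAvg_eq_avg_update e,
    cubeAvg_eq_avg_update e fun z => 10 * _]
  refine cubeAvg_mono fun z => ?_
  have hcompl : ∀ b, (fun l => !(Function.update z e b l)) =
      Function.update (fun l => !z l) e (!b) := by
    intro b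
    ext l
    by_cases h : l = e
    · subst h; simp
    · simp [h]
  simp only [maskOff_eq, hcompl, update_maskOn_update_left]
  rw [cubeAvg_maskOn_of_true f e (Function.update z e true) (by simp),
    cubeAvg_maskOn_of_false f e (Function.update z e false) (by simp),
    cubeAvg_bitSign_maskOn_of_true f e (Function.update z e true) (by simp),
    cubeAvg_maskOn_of_true g e (Function.update (fun l => !z l) e (!false)) (by simp),
    cubeAvg_maskOn_of_false g e (Function.update (fun l => !z l) e (!true)) (by simp),
    cubeAvg_bitSign_maskOn_of_true g e (Function.update (fun l => !z l) e (!false)) (by simp)]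
  simp only [condAvg_update]
  have h := four_point_inequality (condAvg_nonneg hf e false z) (condAvg_nonneg hf e true z)
    (condAvg_nonneg hg e false fun l => !z l) (condAvg_nonneg hg e true fun l => !z l)
  -- The two correlation terms in which `e` lies on the wrong side are nonnegative and simply
  -- dropped.
  have h1 : 0 ≤ |cubeAvg fun X => bitSign (X e) * f (maskOn (Function.update z e false) X)| *
      ((condAvg g e false (fun l => !z l) + condAvg g e true (fun l => !z l)) / 2) :=
    mul_nonneg (abs_nonneg _) (div_nonneg (add_nonneg (condAvg_nonneg hg _ _ _)
      (condAvg_nonneg hg _ _ _)) zero_le_two)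
  have h2 : 0 ≤ ((condAvg f e false z + condAvg f e true z) / 2) *
      |cubeAvg fun X => bitSign (X e) * g (maskOn (Function.update (fun l => !z l) e (!true)) X)| :=
    mul_nonneg (div_nonneg (add_nonneg (condAvg_nonneg hf _ _ _)
      (condAvg_nonneg hf _ _ _)) zero_le_two) (abs_nonneg _)
  simp only [condAvg] at h h1 h2 ⊢
  linarith

/-- This trades the unknown mass in the logarithm for a threshold `q` chosen in advance; it is log t
≤ t - 1 at t = q/ρ. -/
theorem mul_neg_log_le {ρ q : ℝ} (hρ : 0 ≤ ρ) (hq : 0 < q) :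
    ρ * -Real.log ρ ≤ ρ * -Real.log q + q := by
  rcases hρ.eq_or_lt with rfl | hρ
  · simpa using hq.le
  have h := Real.log_le_sub_one_of_pos (div_pos hq hρ)
  rw [Real.log_div hq.ne' hρ.ne'] at h
  have h2 := mul_le_mul_of_nonneg_left h hρ.le
  have h3 : ρ * (q / ρ - 1) = q - ρ := by field_simp
  nlinarith

/-- Corruption of a single rectangle, summed over the elements. -/
theorem rectangle_corruption (f g : (Fin r → Bool) → ℝ) (hf : ∀ X, 0 ≤ f X) (hf1 : ∀ X, f X ≤ 1)
    (hg : ∀ X, 0 ≤ g X) (hg1 : ∀ X, g X ≤ 1) {lam q : ℝ} (hl : 0 < lam) (hq : 0 < q) :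
    r * cubeAvg (fun z => cubeAvg (fun X => f (maskOn z X)) * cubeAvg fun Y => g (maskOff z Y)) -
      ∑ e, cubeAvg (fun z => cubeAvg (fun X => f (Function.update (maskOn z X) e true)) *
        cubeAvg fun Y => g (Function.update (maskOff z Y) e true)) ≤
    10 / lam * (cubeAvg (fun z => cubeAvg (fun X => f (maskOn z X)) *
      cubeAvg fun Y => g (maskOff z Y)) * (lam ^ 2 * r - Real.log q) + q) := by
  have h1 := Finset.sum_le_sum fun e (_ : e ∈ Finset.univ) =>
    rectangle_corruption_coord f g hf hg e
  rw [Finset.sum_sub_distrib, Finset.sum_const, Finset.card_univ, Fintype.card_fin, nsmul_eq_mul,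
    ← Finset.mul_sum, ← cubeAvg_sum Finset.univ fun e z =>
      |cubeAvg fun X => bitSign (X e) * f (maskOn z X)| * cubeAvg (fun Y => g (maskOff z Y)) +
      cubeAvg (fun X => f (maskOn z X)) * |cubeAvg fun Y => bitSign (Y e) * g (maskOff z Y)|] at h1
  refine h1.trans ?_
  rw [← cubeAvg_mul_left, div_mul_eq_mul_div, le_div_iff₀ hl, ← cubeAvg_mul_right]
  have h2 : ∀ z : Fin r → Bool,
      10 * (∑ e, (|cubeAvg fun X => bitSign (X e) * f (maskOn z X)| *
        cubeAvg (fun Y => g (maskOff z Y)) + cubeAvg (fun X => f (maskOn z X)) *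
        |cubeAvg fun Y => bitSign (Y e) * g (maskOff z Y)|)) * lam ≤
      10 * ((cubeAvg (fun X => f (maskOn z X)) * cubeAvg fun Y => g (maskOff z Y)) *
        (lam ^ 2 * r - Real.log q) + q) := by
    intro z
    have hF := sum_abs_cubeAvg_bitSign_le (lam := lam) (fun X => f (maskOn z X)) (fun _ => hf _)
      fun _ => hf1 _
    have hG := sum_abs_cubeAvg_bitSign_le (lam := lam) (fun X => g (maskOff z X)) (fun _ => hg _)
      fun _ => hg1 _
    have hF0 : 0 ≤ cubeAvg fun X => f (maskOn z X) := cubeAvg_nonneg fun _ => hf _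
    have hG0 : 0 ≤ cubeAvg fun X => g (maskOff z X) := cubeAvg_nonneg fun _ => hg _
    rw [Finset.sum_add_distrib, ← Finset.sum_mul, ← Finset.mul_sum]
    set F := cubeAvg fun X => f (maskOn z X)
    set G := cubeAvg fun X => g (maskOff z X)
    have hF' := mul_le_mul_of_nonneg_right hF hG0
    have hG' := mul_le_mul_of_nonneg_left hG hF0
    have hlog : F * G * Real.log (F * G) = F * G * (Real.log F + Real.log G) := by
      rcases hF0.eq_or_lt with h | hFp
      · rw [← h]; simp
      rcases hG0.eq_or_lt with h | hGp
      · rw [← h]; simp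
      rw [Real.log_mul hFp.ne' hGp.ne']
    have hq' := mul_neg_log_le (mul_nonneg hF0 hG0) hq
    nlinarith
  refine (cubeAvg_mono h2).trans_eq ?_
  rw [cubeAvg_mul_left, cubeAvg_add, cubeAvg_const, cubeAvg_mul_right]

end Cube

/-! ### The disjoint and the meeting input distributions. -/

section Distribution

variable {r : ℕ} {J : Type*} [Fintype J] [DecidableEq J]

/-- The joint law of two disjoint random sets: split the elements at random into two parts and
take a random subset of each. -/
noncomputable def pairLaw (A T : Fin r → Bool) : ℝ :=
  cubeAvg fun z => cubeAvg (fun X => if maskOn z X = A then 1 else 0) *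
    cubeAvg fun Y => if maskOff z Y = T then 1 else 0

/-- The second marginal of `pairLaw`. -/
noncomputable def hubLaw (T : Fin r → Bool) : ℝ := ∑ A, pairLaw A T

/-- The law of the first set given the second one. -/
noncomputable def condLaw (T A : Fin r → Bool) : ℝ := pairLaw A T / hubLaw T

theorem sum_cubeAvg_indicator_mul (f : (Fin r → Bool) → ℝ) (φ : (Fin r → Bool) → Fin r → Bool) :
    ∑ A, cubeAvg (fun X => if φ X = A then 1 else 0) * f A = cubeAvg fun X => f (φ X) := by
  simp_rw [← cubeAvg_mul_right]
  rw [← cubeAvg_sum]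
  congr 1
  ext X
  simp

/-- Given `z` the two sets are independent; all the dependence comes from averaging over `z`. -/
theorem sum_pairLaw_mul (f g : (Fin r → Bool) → ℝ) :
    ∑ T, ∑ A, pairLaw A T * (f A * g T) =
      cubeAvg fun z => cubeAvg (fun X => f (maskOn z X)) * cubeAvg fun Y => g (maskOff z Y) := by
  simp_rw [← sum_cubeAvg_indicator_mul f, ← sum_cubeAvg_indicator_mul g, Finset.sum_mul_sum]
  rw [cubeAvg_sum, Finset.sum_comm]
  refine Finset.sum_congr rfl fun A _ => ?_
  rw [cubeAvg_sum]
  refine Finset.sum_congr rfl fun T _ => ?_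
  rw [pairLaw, ← cubeAvg_mul_right]
  congr 1
  ext z
  ring

theorem pairLaw_nonneg (A T : Fin r → Bool) : 0 ≤ pairLaw A T := by
  refine cubeAvg_nonneg fun z => mul_nonneg ?_ ?_ <;>
  · refine cubeAvg_nonneg fun X => ?_
    split_ifs <;> norm_num

theorem cubeAvg_pos {F : (Fin r → Bool) → ℝ} (h : ∀ X, 0 ≤ F X) (X : Fin r → Bool)
    (hX : 0 < F X) : 0 < cubeAvg F :=
  div_pos (Finset.sum_pos' (fun X _ => h X) ⟨X, Finset.mem_univ X, hX⟩) (by positivity)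

/-- Positivity at every `T` makes `condLaw T` a probability law also at the hub sets of `meetAvg`,
where an element has been added. -/
theorem hubLaw_pos (T : Fin r → Bool) : 0 < hubLaw T := by
  refine Finset.sum_pos' (fun A _ => pairLaw_nonneg A T)
    ⟨fun _ => false, Finset.mem_univ _, ?_⟩
  have h0 : ∀ (φ : (Fin r → Bool) → Fin r → Bool) (A X : Fin r → Bool),
      (0 : ℝ) ≤ if φ X = A then 1 else 0 := by
    intro φ A X
    split_ifs <;> norm_num
  refine cubeAvg_pos (fun z => mul_nonneg (cubeAvg_nonneg (h0 _ _)) (cubeAvg_nonneg (h0 _ _)))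
    (fun _ => false) (mul_pos ?_ ?_)
  · refine cubeAvg_pos (h0 _ _) (fun _ => false) ?_
    rw [if_pos (show maskOn (fun _ => false) (fun _ => false) = fun _ : Fin r => false from rfl)]
    exact one_pos
  · refine cubeAvg_pos (h0 _ _) T ?_
    rw [if_pos (show maskOff (fun _ => false) T = T from rfl)]
    exact one_pos

theorem condLaw_nonneg (T A : Fin r → Bool) : 0 ≤ condLaw T A :=
  div_nonneg (pairLaw_nonneg A T) (hubLaw_pos T).le

theorem sum_condLaw (T : Fin r → Bool) : ∑ A, condLaw T A = 1 := by
  simp only [condLaw, ← Finset.sum_div]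
  exact div_self (hubLaw_pos T).ne'

theorem hubLaw_mul_condLaw (T A : Fin r → Bool) : hubLaw T * condLaw T A = pairLaw A T :=
  mul_div_cancel₀ _ (hubLaw_pos T).ne'

theorem sum_hubLaw : ∑ T : Fin r → Bool, hubLaw T = 1 := by
  have := sum_pairLaw_mul (r := r) (fun _ => 1) fun _ => 1
  simpa [cubeAvg_const, hubLaw] using this

theorem condLaw_eq_zero {T A : Fin r → Bool} {e : Fin r} (hA : A e = true) (hT : T e = true) :
    condLaw T A = 0 := by
  have : pairLaw A T = 0 := by
    unfold pairLaw
    rw [show (fun z : Fin r → Bool => cubeAvg (fun X => if maskOn z X = A then (1 : ℝ) else 0) *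
      cubeAvg fun Y => if maskOff z Y = T then (1 : ℝ) else 0) = fun _ => 0 from ?_, cubeAvg_const]
    ext z
    cases hz : z e
    · have h : ∀ X, maskOn z X ≠ A := by
        rintro X rfl
        simp [maskOn, hz] at hA
      simp [h, cubeAvg_const]
    · have h : ∀ X, maskOff z X ≠ T := by
        rintro X rfl
        simp [maskOff, hz] at hT
      simp [h, cubeAvg_const]
  simp [condLaw, this]

/-- The inputs of the hub-and-sites disjointness problem: the set of the hub and the sets of the
other sites. -/
abbrev HubInput (r : ℕ) (J : Type*) := (Fin r → Bool) × (J → Fin r → Bool)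

/-- The average over the other sites' sets given the set of the hub. -/
noncomputable def sitesAvg (T : Fin r → Bool) (F : (J → Fin r → Bool) → ℝ) : ℝ :=
  ∑ S : J → Fin r → Bool, (∏ l, condLaw T (S l)) * F S

theorem sitesAvg_add (T : Fin r → Bool) (F G : (J → Fin r → Bool) → ℝ) :
    sitesAvg T (fun S => F S + G S) = sitesAvg T F + sitesAvg T G := by
  simp [sitesAvg, mul_add, Finset.sum_add_distrib]

theorem sitesAvg_mul_left (T : Fin r → Bool) (a : ℝ) (F : (J → Fin r → Bool) → ℝ) :
    sitesAvg T (fun S => a * F S) = a * sitesAvg T F := by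
  simp only [sitesAvg, Finset.mul_sum]
  exact Finset.sum_congr rfl fun S _ => by ring

theorem sitesAvg_mono (T : Fin r → Bool) {F G : (J → Fin r → Bool) → ℝ}
    (h : ∀ S, (∀ j e, ¬ (S j e = true ∧ T e = true)) → F S ≤ G S) :
    sitesAvg T F ≤ sitesAvg T G := by
  refine Finset.sum_le_sum fun S _ => ?_
  by_cases hS : ∀ j e, ¬ (S j e = true ∧ T e = true)
  · exact mul_le_mul_of_nonneg_left (h S hS) (Finset.prod_nonneg fun _ _ => condLaw_nonneg _ _)
  · push Not at hS
    obtain ⟨j, e, h1, h2⟩ := hS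
    rw [Finset.prod_eq_zero (Finset.mem_univ j) (condLaw_eq_zero h1 h2), zero_mul, zero_mul]

theorem sitesAvg_const (T : Fin r → Bool) (a : ℝ) :
    sitesAvg T (fun _ : J → Fin r → Bool => a) = a := by
  rw [sitesAvg, ← Finset.sum_mul, ← Fintype.prod_sum fun (_ : J) A => condLaw T A]
  simp [sum_condLaw]

/-- The average over inputs in which the set of the hub is disjoint from all the others. -/
noncomputable def disjointAvg : (HubInput r J → ℝ) →ₗ[ℝ] ℝ where
  toFun F := ∑ T, hubLaw T * sitesAvg T fun S => F (T, S)
  map_add' F G := by simp [sitesAvg_add, mul_add, Finset.sum_add_distrib]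
  map_smul' a F := by
    simp only [Pi.smul_apply, smul_eq_mul, sitesAvg_mul_left, Finset.mul_sum, RingHom.id_apply]
    exact Finset.sum_congr rfl fun T _ => by ring

/-- The average over inputs in which the set of site `j` meets the set of the hub in a random
element. -/
noncomputable def meetAvg (j : J) : (HubInput r J → ℝ) →ₗ[ℝ] ℝ where
  toFun F := (r : ℝ)⁻¹ * ∑ e, cubeAvg fun z => cubeAvg fun X => cubeAvg fun Y =>
    sitesAvg (Function.update (maskOff z Y) e true) fun S =>
      F (Function.update (maskOff z Y) e true,
        Function.update S j (Function.update (maskOn z X) e true))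
  map_add' F G := by
    simp [sitesAvg_add, cubeAvg_add, mul_add, Finset.sum_add_distrib]
  map_smul' a F := by
    simp only [Pi.smul_apply, smul_eq_mul, sitesAvg_mul_left, cubeAvg_mul_left, ← Finset.mul_sum,
      RingHom.id_apply]
    ring

theorem disjointAvg_mono {F G : HubInput r J → ℝ}
    (h : ∀ T S, (∀ j e, ¬ (S j e = true ∧ T e = true)) → F (T, S) ≤ G (T, S)) :
    disjointAvg F ≤ disjointAvg G :=
  Finset.sum_le_sum fun T _ =>
    mul_le_mul_of_nonneg_left (sitesAvg_mono T fun S => h T S) (hubLaw_pos T).le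

theorem disjointAvg_const (a : ℝ) : disjointAvg (fun _ : HubInput r J => a) = a := by
  simp [disjointAvg, sitesAvg_const, ← Finset.sum_mul, sum_hubLaw]

theorem meetAvg_mono (j : J) {F G : HubInput r J → ℝ}
    (h : ∀ T S, (∃ e, S j e = true ∧ T e = true) → F (T, S) ≤ G (T, S)) :
    meetAvg j F ≤ meetAvg j G := by
  refine mul_le_mul_of_nonneg_left ?_ (by positivity)
  refine Finset.sum_le_sum fun e _ => cubeAvg_mono fun z => cubeAvg_mono fun X =>
    cubeAvg_mono fun Y => sitesAvg_mono _ fun S _ => h _ _ ⟨e, by simp⟩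

theorem meetAvg_const (hr : r ≠ 0) (j : J) (a : ℝ) :
    meetAvg j (fun _ : HubInput r J => a) = a := by
  have : (r : ℝ) ≠ 0 := by exact_mod_cast hr
  simp [meetAvg, sitesAvg_const, cubeAvg_const, this]

section Rectangle

variable {j : J} {p : HubInput r J → ℝ} {f : (Fin r → Bool) → ℝ} {g : HubInput r J → ℝ}

/-- Resampling the set of site `j` given the hub's set separates `f` from `g` and rebuilds
`pairLaw`. -/
theorem disjointAvg_rectangle
    (hp : ∀ T S A, p (T, Function.update S j A) = f A * g (T, S)) :
    disjointAvg p = cubeAvg fun z => cubeAvg (fun X => f (maskOn z X)) *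
      cubeAvg fun Y => sitesAvg (maskOff z Y) fun S => g (maskOff z Y, S) := by
  rw [← sum_pairLaw_mul f fun T => sitesAvg T fun S => g (T, S)]
  refine Finset.sum_congr rfl fun T _ => ?_
  rw [sitesAvg, ← sum_prod_resample (condLaw T) (sum_condLaw T) j]
  simp only [hp, ← hubLaw_mul_condLaw]
  simp only [sitesAvg, Finset.mul_sum]
  rw [Finset.sum_comm]
  refine Finset.sum_congr rfl fun A _ => Finset.sum_congr rfl fun S _ => ?_
  ring

theorem meetAvg_rectangle
    (hp : ∀ T S A, p (T, Function.update S j A) = f A * g (T, S)) :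
    meetAvg j p = (r : ℝ)⁻¹ * ∑ e, cubeAvg fun z =>
      cubeAvg (fun X => f (Function.update (maskOn z X) e true)) *
      cubeAvg fun Y => sitesAvg (Function.update (maskOff z Y) e true) fun S =>
        g (Function.update (maskOff z Y) e true, S) := by
  simp only [meetAvg, LinearMap.coe_mk, AddHom.coe_mk, hp, sitesAvg_mul_left, cubeAvg_mul_left,
    cubeAvg_mul_right]

/-- Under both laws the other sites' sets depend on the hub's set only. Averaging `g` over them
leaves a two-party rectangle with values in [0, 1]. -/
theorem disjointAvg_sub_meetAvg_le_of_rectangle (hr : r ≠ 0)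
    (hp : ∀ T S A, p (T, Function.update S j A) = f A * g (T, S))
    (hf : ∀ A, 0 ≤ f A) (hf1 : ∀ A, f A ≤ 1) (hg : ∀ y, 0 ≤ g y) (hg1 : ∀ y, g y ≤ 1)
    {lam q : ℝ} (hl : 0 < lam) (hq : 0 < q) :
    r * (disjointAvg p - meetAvg j p) ≤
      10 / lam * (disjointAvg p * (lam ^ 2 * r - Real.log q) + q) := by
  have hr' : (r : ℝ) ≠ 0 := by exact_mod_cast hr
  have h0 : ∀ T, 0 ≤ sitesAvg T fun S : J → Fin r → Bool => g (T, S) := fun T =>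
    (sitesAvg_const T 0).symm.trans_le (sitesAvg_mono T fun S _ => hg _)
  have h1 : ∀ T, sitesAvg T (fun S : J → Fin r → Bool => g (T, S)) ≤ 1 := fun T =>
    (sitesAvg_mono T fun S _ => hg1 _).trans_eq (sitesAvg_const T 1)
  have h := rectangle_corruption f (fun T => sitesAvg T fun S => g (T, S)) hf hf1 h0 h1 hl hq
  rw [disjointAvg_rectangle hp, meetAvg_rectangle hp, mul_sub, mul_inv_cancel_left₀ hr']
  exact h

end Rectangle

theorem disjointAvg_sub_meetAvg_le {ι : Type*} (V : Finset ι) (j : J) (p : ι → HubInput r J → ℝ)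
    (f : ι → (Fin r → Bool) → ℝ) (g : ι → HubInput r J → ℝ) (hr : r ≠ 0)
    (hp : ∀ v T S A, p v (T, Function.update S j A) = f v A * g v (T, S))
    (hf : ∀ v A, 0 ≤ f v A) (hf1 : ∀ v A, f v A ≤ 1) (hg : ∀ v y, 0 ≤ g v y)
    (hg1 : ∀ v y, g v y ≤ 1) {lam : ℝ} {q : ι → ℝ} (hl : 0 < lam) (hq : ∀ v, 0 < q v) :
    r * (disjointAvg (∑ v ∈ V, p v) - meetAvg j (∑ v ∈ V, p v)) ≤
      10 / lam * (disjointAvg (∑ v ∈ V, (lam ^ 2 * r - Real.log (q v)) • p v) +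
        ∑ v ∈ V, q v) := by
  simp only [map_sum, map_smul, smul_eq_mul]
  rw [← Finset.sum_sub_distrib, Finset.mul_sum, ← Finset.sum_add_distrib, Finset.mul_sum]
  refine Finset.sum_le_sum fun v _ => ?_
  rw [mul_comm (lam ^ 2 * r - Real.log (q v))]
  exact disjointAvg_sub_meetAvg_le_of_rectangle hr (hp v) (hf v) (hf1 v) (hg v) (hg1 v) hl (hq v)

end Distribution

/-! ### From protocols to the communication bound for disjointness. -/

open MeasureTheory in
/-- Averaging over the tapes: some tape is at most as bad as the average one. -/
theorem exists_linear_indicator_le {Ω I : Type*} [MeasurableSpace Ω] [Fintype I] [DecidableEq I]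
    (μ : Measure Ω) [IsProbabilityMeasure μ] (L : (I → ℝ) →ₗ[ℝ] ℝ) (hL : ∀ F, 0 ≤ F → 0 ≤ L F)
    (bad : I → Set Ω) {ε : ℝ} (hε : 0 ≤ ε) (hbad : ∀ i, μ (bad i) ≤ ENNReal.ofReal ε) :
    ∃ ω, L (fun i => (bad i).indicator (fun _ => 1) ω) ≤ ε * L fun _ => 1 := by
  set w : I → ℝ := fun i => L fun j => if i = j then 1 else 0 with hw
  have hw0 : ∀ i, 0 ≤ w i := fun i => hL _ fun j => by
    simp only [Pi.zero_apply]
    split_ifs <;> norm_num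
  have hLw : ∀ F, L F = ∑ i, w i * F i := by
    intro F
    rw [LinearMap.pi_apply_eq_sum_univ L F]
    exact Finset.sum_congr rfl fun i _ => by rw [smul_eq_mul, mul_comm]
  -- The bad events need not be measurable, so measurable hulls of the same measure replace them.
  let φ : Ω → ℝ≥0∞ := fun ω =>
    ∑ i, ENNReal.ofReal (w i) * (toMeasurable μ (bad i)).indicator (fun _ => 1) ω
  have hmeas : ∀ i, Measurable ((toMeasurable μ (bad i)).indicator fun _ => (1 : ℝ≥0∞)) :=
    fun i => measurable_const.indicator (measurableSet_toMeasurable _ _)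
  have hφ : Measurable φ := Finset.measurable_sum _ fun i _ => (hmeas i).const_mul _
  obtain ⟨ω, hω⟩ := exists_le_lintegral (μ := μ) hφ.aemeasurable
  refine ⟨ω, ?_⟩
  have hint : ∫⁻ a, φ a ∂μ ≤ ENNReal.ofReal (ε * L fun _ => 1) := by
    rw [lintegral_finsetSum _ fun i _ => (hmeas i).const_mul _]
    calc _ = ∑ i, ENNReal.ofReal (w i) * μ (bad i) := by
          refine Finset.sum_congr rfl fun i _ => ?_
          rw [lintegral_const_mul _ (hmeas i),
            lintegral_indicator_const (measurableSet_toMeasurable _ _), one_mul,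
            measure_toMeasurable]
      _ ≤ ∑ i, ENNReal.ofReal (w i) * ENNReal.ofReal ε := by
          gcongr with i
          exact hbad i
      _ = _ := by
          simp_rw [← ENNReal.ofReal_mul (hw0 _)]
          rw [← ENNReal.ofReal_sum_of_nonneg fun i _ => mul_nonneg (hw0 i) hε, hLw,
            ← Finset.sum_mul, mul_comm]
          simp
  have hle : ENNReal.ofReal (L fun i => (bad i).indicator (fun _ => 1) ω) ≤ φ ω := by
    rw [hLw, ENNReal.ofReal_sum_of_nonneg fun i _ =>
      mul_nonneg (hw0 i) (Set.indicator_nonneg (fun _ _ => zero_le_one) _)]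
    refine Finset.sum_le_sum fun i _ => ?_
    rw [ENNReal.ofReal_mul (hw0 i)]
    gcongr
    by_cases h : ω ∈ bad i
    · simp [h, subset_toMeasurable μ (bad i) h]
    · simp [h]
  have hL1 : 0 ≤ L fun _ => 1 := hL _ fun _ => zero_le_one
  exact (ENNReal.ofReal_le_ofReal_iff (mul_nonneg hε hL1)).1 (hle.trans (hω.trans hint))

namespace MessagePassing

namespace Protocol

open MeasureTheory

variable {k r : ℕ} {X T : Type} {J : Type} [Fintype J] [DecidableEq J]

open Classical in
/-- The core estimate for a deterministic protocol (fixed tapes `ρ`) on the inputs `enc y`,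
where site `emb j` holds the set of index `j`. -/
theorem disjointAvg_sub_meetAvg_accept_le (P : Protocol k X T) (ρ : Fin k → T) (hk : 1 ≤ k)
    (hr : r ≠ 0) (emb : J ↪ Fin k) (enc : HubInput r J → Fin k → X)
    (σ : J → (Fin r → Bool) → X)
    (henc : ∀ U S j A, enc (U, Function.update S j A) =
      Function.update (enc (U, S)) (emb j) (σ j A))
    (τ : HubInput r J → Transcript k) (hτ : ∀ y, P.HaltsWith (enc y) ρ (τ y)) (j : J)
    {lam : ℝ} (hl : 0 < lam) (acc : HubInput r J → ℝ)
    (hacc : ∀ y, acc y = if P.report (enc y) ρ (τ y) = true then 1 else 0) :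
    r * (disjointAvg acc - meetAvg j acc) ≤
      10 / lam * (lam ^ 2 * r + Real.log (8 * (k : ℝ) ^ 2) *
        disjointAvg (fun y => ((Transcript.view (emb j) (τ y)).bits : ℝ)) + 4) := by
  have hk' : (1 : ℝ) ≤ k := by exact_mod_cast hk
  -- The view of site `j` alone does not tell whether `j` reports; the extra bit is needed for the
  -- accepted inputs to form rectangles.
  set idx : HubInput r J → Transcript k × Bool := fun y =>
    (Transcript.view (emb j) (τ y), decide (P.reporter (τ y) = emb j)) with hidx
  set R : Transcript k × Bool → HubInput r J → Prop := fun v y =>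
    idx y = v ∧ P.report (enc y) ρ (τ y) = true with hR
  have hself : ∀ U S A, enc (U, Function.update S j A) (emb j) = σ j A := by
    intro U S A
    rw [henc, Function.update_self]
  have hrect : ∀ v U S A U' S' A', R v (U, Function.update S j A) →
      R v (U', Function.update S' j A') → R v (U, Function.update S j A') := by
    rintro v U S A U' S' A' ⟨h1, h2⟩ ⟨h1', h2'⟩
    have h12 := h1.trans h1'.symm
    simp only [hidx, Prod.mk.injEq, decide_eq_decide] at h12
    have hup := (hτ (U, Function.update S j A)).update (hτ (U', Function.update S' j A')) h12.1
    have hin : Function.update (enc (U, Function.update S j A)) (emb j)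
        (enc (U', Function.update S' j A') (emb j)) = enc (U, Function.update S j A') := by
      rw [hself, henc, henc, Function.update_idem]
    rw [hin] at hup
    have hτeq := (hτ _).unique hup
    refine ⟨?_, ?_⟩
    · rw [← h1]
      simp only [hidx, hτeq]
    · rw [hτeq]
      -- If `j` reports, its answer depends on `A'` and the common view, as in the second input;
      -- otherwise the reporter cannot tell the new input from the first.
      unfold report at h2 h2' ⊢
      by_cases hrep : P.reporter (τ (U, Function.update S j A)) = emb j
      · have hrep' := h12.2.1 hrep
        rw [hrep, hself]
        rw [hrep', hself] at h2'
        rw [h12.1]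
        exact h2'
      · have : enc (U, Function.update S j A') (P.reporter (τ (U, Function.update S j A))) =
            enc (U, Function.update S j A) (P.reporter (τ (U, Function.update S j A))) := by
          rw [henc, henc, Function.update_of_ne hrep, Function.update_of_ne hrep]
        rw [this]
        exact h2
  set V : Finset (Transcript k × Bool) :=
    (Finset.univ.image fun y => Transcript.view (emb j) (τ y)) ×ˢ Finset.univ with hV
  set θ : ℝ := 1 / (8 * (k : ℝ) ^ 2) with hθ
  have hθpos : 0 < θ := by positivity
  -- The threshold of a rectangle is the Kraft weight of its view, so -log of it is log(8k²) times
  -- the bits seen. The thresholds sum to at most 4: a Kraft sum of 2 for each value of the extra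
  -- bit.
  have key := disjointAvg_sub_meetAvg_le V j (fun v y => if R v y then (1 : ℝ) else 0)
    (fun v A => if ∃ U S, R v (U, Function.update S j A) then 1 else 0)
    (fun v y => if ∃ A, R v (y.1, Function.update y.2 j A) then 1 else 0) hr ?_
    (fun _ _ => by split_ifs <;> norm_num) (fun _ _ => by split_ifs <;> norm_num)
    (fun _ _ => by split_ifs <;> norm_num) (fun _ _ => by split_ifs <;> norm_num)
    hl (fun v => pow_pos hθpos v.1.bits)
  · have hsum : ∀ c : Transcript k × Bool → ℝ, ∀ y,
        (∑ v ∈ V, c v • (fun y => if R v y then (1 : ℝ) else 0)) y = c (idx y) * acc y := by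
      intro c y
      rw [Finset.sum_apply, Finset.sum_eq_single (idx y)]
      · simp [hR, hacc]
      · intro v _ hv
        simp [hR, hv.symm]
      · intro h
        exact absurd (by simp [hV, hidx, Classical.em]) h
    have hacc_eq : ∑ v ∈ V, (fun y => if R v y then (1 : ℝ) else 0) = acc := by
      ext y
      have := hsum (fun _ => 1) y
      simpa using this
    rw [hacc_eq] at key
    refine key.trans ?_
    gcongr ?_ * (?_ + ?_)
    · calc _ ≤ disjointAvg (((lam ^ 2 * r) • (fun _ : HubInput r J => (1 : ℝ))) +
            Real.log (8 * (k : ℝ) ^ 2) •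
              fun y => ((Transcript.view (emb j) (τ y)).bits : ℝ)) := by
            refine disjointAvg_mono fun U S _ => ?_
            rw [hsum]
            have hlog : -Real.log (θ ^ (idx (U, S)).1.bits) = Real.log (8 * (k : ℝ) ^ 2) *
                ((Transcript.view (emb j) (τ (U, S))).bits : ℝ) := by
              rw [Real.log_pow, hθ, one_div, Real.log_inv]
              simp only [hidx]
              ring
            have h0 : 0 ≤ Real.log (8 * (k : ℝ) ^ 2) *
                ((Transcript.view (emb j) (τ (U, S))).bits : ℝ) :=
              mul_nonneg (Real.log_nonneg (by nlinarith)) (Nat.cast_nonneg _)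
            rw [sub_eq_add_neg, hlog]
            simp only [Pi.add_apply, Pi.smul_apply, smul_eq_mul, mul_one]
            refine mul_le_of_le_one_right (add_nonneg (by positivity) h0) ?_
            rw [hacc]
            split_ifs <;> norm_num
        _ = _ := by
            rw [map_add, map_smul, map_smul, disjointAvg_const]
            simp
    · rw [hV, Finset.sum_product_right, Fintype.sum_bool]
      have := sum_pow_bits_le_two hk (Finset.univ.image fun y => Transcript.view (emb j) (τ y))
        (by
          intro t ht e he
          obtain ⟨y, _, rfl⟩ := Finset.mem_image.1 ht
          exact (hτ y).payload_ne_nil e (List.mem_of_mem_filter he))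
      simp only [← hθ] at this
      linarith
  · intro v U S A
    simp only
    by_cases h : R v (U, Function.update S j A)
    · rw [if_pos h, if_pos ⟨U, S, h⟩, if_pos ⟨A, h⟩, one_mul]
    · rw [if_neg h]
      by_cases h1 : ∃ U S, R v (U, Function.update S j A)
      · obtain ⟨U', S', h1⟩ := h1
        rw [if_pos ⟨U', S', h1⟩, one_mul, if_neg]
        rintro ⟨A', h2⟩
        exact h (hrect v U S A' U' S' A h2 h1)
      · rw [if_neg h1, zero_mul]

open Classical in
/-- Communication lower bound for every problem into which the hub-and-sites disjointness
problem embeds. -/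
theorem card_mul_le_of_disjointness [Nonempty J] [MeasurableSpace T] (P : Protocol k X T)
    (μ : Measure (Fin k → T)) [IsProbabilityMeasure μ] {dom : Set (Fin k → X)}
    {f : (Fin k → X) → Prop} {b : ℕ} (hcost : P.CostAtMost dom b)
    (herr : P.ComputesWithError μ dom f (1 / 3)) (hk : 1 ≤ k) (hr : 40000 ≤ r)
    (emb : J ↪ Fin k) (enc : HubInput r J → Fin k → X) (σ : J → (Fin r → Bool) → X)
    (henc : ∀ U S j A, enc (U, Function.update S j A) =
      Function.update (enc (U, S)) (emb j) (σ j A))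
    (hdom : ∀ y, enc y ∈ dom)
    (hf : ∀ U S, f (enc (U, S)) ↔ ∀ j e, ¬ (S j e = true ∧ U e = true)) :
    (Fintype.card J : ℝ) * r ≤ 15000 * (Real.log (8 * (k : ℝ) ^ 2) * b) := by
  have hr0 : r ≠ 0 := by omega
  have hr' : (40000 : ℝ) ≤ r := by exact_mod_cast hr
  have hJ : 0 < (Fintype.card J : ℝ) := by exact_mod_cast Fintype.card_pos
  have hk' : (1 : ℝ) ≤ k := by exact_mod_cast hk
  have hκ : 0 ≤ Real.log (8 * (k : ℝ) ^ 2) := Real.log_nonneg (by nlinarith)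
  set M : (HubInput r J → ℝ) →ₗ[ℝ] ℝ := (Fintype.card J : ℝ)⁻¹ • ∑ j, meetAvg j with hM
  have hMapp : ∀ F, M F = (Fintype.card J : ℝ)⁻¹ * ∑ j, meetAvg j F := by
    intro F
    simp [hM, LinearMap.sum_apply]
  have hM1 : M (fun _ => 1) = 1 := by
    rw [hMapp]
    simp [meetAvg_const hr0, hJ.ne']
  -- The combined law has mass 2, so some tapes have total error at most 2/3 over both laws. This
  -- leaves an acceptance gap of at least 1/3.
  obtain ⟨ρ, hρ⟩ := exists_linear_indicator_le μ (disjointAvg + M) (by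
      intro F hF
      have h1 : 0 ≤ disjointAvg F :=
        (disjointAvg_const 0).symm.trans_le (disjointAvg_mono fun U S _ => hF _)
      have h2 : ∀ j, 0 ≤ meetAvg j F := fun j =>
        (meetAvg_const hr0 j 0).symm.trans_le (meetAvg_mono j fun U S _ => hF _)
      rw [LinearMap.add_apply, hMapp]
      exact add_nonneg h1 (mul_nonneg (by positivity) (Finset.sum_nonneg fun j _ => h2 j)))
    (fun y => {ρ | ¬ ∃ t, P.HaltsWith (enc y) ρ t ∧ (P.report (enc y) ρ t = true ↔ f (enc y))})
    (ε := 1 / 3) (by norm_num) (by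
      intro y
      refine (herr _ (hdom y)).trans_eq ?_
      rw [one_div, one_div, ENNReal.ofReal_inv_of_pos (by norm_num)]
      simp)
  choose τ hτ hτb using fun y => hcost (enc y) (hdom y) ρ
  set acc : HubInput r J → ℝ := fun y => if P.report (enc y) ρ (τ y) = true then 1 else 0
    with hacc
  have hbad : ∀ y, (ρ ∈ {ρ | ¬ ∃ t, P.HaltsWith (enc y) ρ t ∧
      (P.report (enc y) ρ t = true ↔ f (enc y))}) ↔
        ¬ (P.report (enc y) ρ (τ y) = true ↔ f (enc y)) := by
    intro y
    rw [Set.mem_ofPred_eq, not_iff_not]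
    constructor
    · rintro ⟨t, ht, h⟩
      rwa [(hτ y).unique ht]
    · exact fun h => ⟨_, hτ y, h⟩
  set B : HubInput r J → ℝ := fun y =>
    ({ρ | ¬ ∃ t, P.HaltsWith (enc y) ρ t ∧ (P.report (enc y) ρ t = true ↔ f (enc y))} :
      Set (Fin k → T)).indicator (fun _ => 1) ρ with hB
  have hBval : ∀ y, B y = if (P.report (enc y) ρ (τ y) = true ↔ f (enc y)) then 0 else 1 := by
    intro y
    simp only [hB, Set.indicator_apply, hbad, ite_not]
  rw [LinearMap.add_apply, LinearMap.add_apply, disjointAvg_const, hM1] at hρ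
  have hD : 1 - disjointAvg B ≤ disjointAvg acc := by
    have h1 : disjointAvg ((fun _ : HubInput r J => (1 : ℝ)) - B) ≤ disjointAvg acc := by
      refine disjointAvg_mono fun U S hUS => ?_
      have := (hf U S).2 hUS
      simp only [Pi.sub_apply, hBval, hacc, this, iff_true]
      split_ifs <;> norm_num
    rwa [map_sub, disjointAvg_const] at h1
  have hMj : ∀ j, meetAvg j acc ≤ meetAvg j B := by
    intro j
    refine meetAvg_mono j fun U S hUS => ?_
    have : ¬ f (enc (U, S)) := fun h => by
      obtain ⟨e, he⟩ := hUS
      exact (hf U S).1 h j e he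
    simp only [hBval, hacc, this, iff_false]
    split_ifs <;> norm_num
  have hMle : ∑ j, meetAvg j acc ≤ Fintype.card J * M B := by
    rw [hMapp, mul_inv_cancel_left₀ hJ.ne']
    exact Finset.sum_le_sum fun j _ => hMj j
  -- With λ = 1/100 the prefactor is 1000. Per site, the λ²r term costs r/10 and so, at most, does
  -- the constant 4, as r ≥ 40000. What remains is (1/3 - 1/5)·r = 2r/15 per site against
  -- 2000·log(8k²)·b in total, whence 15000.
  have hcore := Finset.sum_le_sum fun j (_ : j ∈ Finset.univ) =>
    disjointAvg_sub_meetAvg_accept_le P ρ hk hr0 emb enc σ henc τ hτ j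
      (lam := 1 / 100) (by norm_num) acc fun _ => rfl
  rw [← Finset.mul_sum, ← Finset.mul_sum, Finset.sum_sub_distrib, Finset.sum_add_distrib,
    Finset.sum_add_distrib] at hcore
  simp only [Finset.sum_const, Finset.card_univ, nsmul_eq_mul] at hcore
  have hbits : ∑ j, disjointAvg (fun y => ((Transcript.view (emb j) (τ y)).bits : ℝ)) ≤
      2 * b := by
    rw [← map_sum, ← disjointAvg_const (r := r) (J := J) (2 * b : ℝ)]
    refine disjointAvg_mono fun U S _ => ?_
    rw [Finset.sum_apply]
    have h1 := Transcript.sum_bits_view_le emb (τ (U, S))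
    have h2 := hτb (U, S)
    exact_mod_cast h1.trans (Nat.mul_le_mul_left 2 h2)
  set c : ℝ := (Fintype.card J : ℝ) with hc
  have hgap : c / 3 ≤ c * disjointAvg acc - ∑ j, meetAvg j acc := by
    have : c * (1 - disjointAvg B) ≤ c * disjointAvg acc := mul_le_mul_of_nonneg_left hD hJ.le
    have h3 : c * (disjointAvg B + M B) ≤ c * (1 / 3 * (1 + 1)) :=
      mul_le_mul_of_nonneg_left hρ hJ.le
    linarith
  have hgap' := mul_le_mul_of_nonneg_left hgap (Nat.cast_nonneg (α := ℝ) r)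
  have hκb := mul_le_mul_of_nonneg_left hbits hκ
  have hcr : c * 40000 ≤ c * r := mul_le_mul_of_nonneg_left hr' hJ.le
  norm_num at hcore
  rw [← Finset.mul_sum] at hcore
  linarith

end Protocol

end MessagePassing

/-! ### The reduction from disjointness to bipartiteness. -/

namespace MessagePassing

/-- The vertices of the reduction: the hub (`none`) and the other sites, the elements, and two
sides for filler edges. -/
abbrev GadgetVertex (k' r a : ℕ) := Option (Fin k') ⊕ Fin r ⊕ Fin a ⊕ Fin a

/-- The edges of the reduction: one for each site and element, one for each site that is not the
hub, and some filler edges. -/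
abbrev GadgetEdge (k' r d : ℕ) := (Option (Fin k') × Fin r) ⊕ Fin k' ⊕ Fin d

/-- The places of filler edges. -/
abbrev FillerSlot (k' r d : ℕ) := (Option (Fin k') × Fin r) ⊕ Fin d

section Gadget

variable {n k k' r a d : ℕ}

/-- Does the set of the given site contain the given element? -/
def hubBit (y : HubInput r (Fin k')) : Option (Fin k') → Fin r → Bool
  | none => y.1
  | some j => y.2 j

/-- The filler edge in the given place. -/
def fillerPair (ψ : FillerSlot k' r d → Fin a × Fin a) (x : FillerSlot k' r d) :
    GadgetVertex k' r a × GadgetVertex k' r a :=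
  (Sum.inr (Sum.inr (Sum.inl (ψ x).1)), Sum.inr (Sum.inr (Sum.inr (ψ x).2)))

/-- The ends of the edges of the reduction. Membership of an element in the set of a site is
encoded by an edge between them; a filler edge stands for non-membership. -/
def gadgetPair (ψ : FillerSlot k' r d → Fin a × Fin a) (y : HubInput r (Fin k')) :
    GadgetEdge k' r d → GadgetVertex k' r a × GadgetVertex k' r a
  | Sum.inl (o, e) =>
      if hubBit y o e then (Sum.inl o, Sum.inr (Sum.inl e)) else fillerPair ψ (Sum.inl (o, e))
  | Sum.inr (Sum.inl j) => (Sum.inl none, Sum.inl (some j))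
  | Sum.inr (Sum.inr t) => fillerPair ψ (Sum.inr t)

/-- The kind of a vertex; edges of the reduction run from smaller to larger kinds. -/
def gadgetKind : GadgetVertex k' r a → ℕ
  | Sum.inl none => 0
  | Sum.inl (some _) => 1
  | Sum.inr (Sum.inl _) => 2
  | Sum.inr (Sum.inr (Sum.inl _)) => 3
  | Sum.inr (Sum.inr (Sum.inr _)) => 4

/-- This orientation excludes loops and lets an unordered edge determine its ordered pair of ends.
-/
theorem kind_lt_kind (ψ : FillerSlot k' r d → Fin a × Fin a) (y : HubInput r (Fin k'))
    (x : GadgetEdge k' r d) :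
    gadgetKind (gadgetPair ψ y x).1 < gadgetKind (gadgetPair ψ y x).2 := by
  rcases x with ⟨_ | j, e⟩ | j | t <;> simp only [gadgetPair] <;> try split_ifs
  all_goals simp [gadgetKind, fillerPair]

theorem gadgetPair_injective {ψ : FillerSlot k' r d → Fin a × Fin a}
    (hψ : Function.Injective ψ) (y : HubInput r (Fin k')) :
    Function.Injective (gadgetPair ψ y) := by
  have hf : Function.Injective (fillerPair ψ) := by
    intro x x' h
    simp only [fillerPair, Prod.mk.injEq, Sum.inr.injEq, Sum.inl.injEq] at h
    exact hψ (Prod.ext h.1 h.2)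
  have hf1 : ∀ x o v, fillerPair ψ x ≠ (Sum.inl o, v) := by simp [fillerPair]
  rintro (⟨o, e⟩ | j | t) (⟨o', e'⟩ | j' | t') h <;> simp only [gadgetPair] at h
  · split_ifs at h
    · simpa using h
    · exact absurd h.symm (hf1 _ _ _)
    · exact absurd h (hf1 _ _ _)
    · exact Sum.inl_injective (hf h) ▸ rfl
  · split_ifs at h
    · simp at h
    · exact absurd h (hf1 _ _ _)
  · split_ifs at h
    · exact absurd h.symm (hf1 _ _ _)
    · simpa using hf h
  · split_ifs at h
    · simp at h
    · exact absurd h.symm (hf1 _ _ _)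
  · simpa using h
  · exact absurd h.symm (hf1 _ _ _)
  · split_ifs at h
    · exact absurd h (hf1 _ _ _)
    · simpa using hf h
  · exact absurd h (hf1 _ _ _)
  · simpa using hf h

/-- The edges of the reduction in a graph on `Fin n`. -/
def gadgetSym2 (ι : GadgetVertex k' r a → Fin n) (ψ : FillerSlot k' r d → Fin a × Fin a)
    (y : HubInput r (Fin k')) (x : GadgetEdge k' r d) : Sym2 (Fin n) :=
  s(ι (gadgetPair ψ y x).1, ι (gadgetPair ψ y x).2)

theorem gadgetSym2_injective {ι : GadgetVertex k' r a → Fin n} (hι : Function.Injective ι)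
    {ψ : FillerSlot k' r d → Fin a × Fin a} (hψ : Function.Injective ψ)
    (y : HubInput r (Fin k')) : Function.Injective (gadgetSym2 ι ψ y) := by
  intro x x' h
  rcases Sym2.eq_iff.1 h with ⟨h1, h2⟩ | ⟨h1, h2⟩
  · exact gadgetPair_injective hψ y (Prod.ext (hι h1) (hι h2))
  · have h3 := kind_lt_kind ψ y x
    have h4 := kind_lt_kind ψ y x'
    rw [hι h1, hι h2] at h3
    exact absurd h3 h4.asymm

theorem not_isDiag_gadgetSym2 {ι : GadgetVertex k' r a → Fin n} (hι : Function.Injective ι)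
    (ψ : FillerSlot k' r d → Fin a × Fin a) (y : HubInput r (Fin k')) (x : GadgetEdge k' r d) :
    ¬ (gadgetSym2 ι ψ y x).IsDiag := by
  intro h
  have h3 := kind_lt_kind ψ y x
  rw [hι (Sym2.mk_isDiag_iff.1 h)] at h3
  exact lt_irrefl _ h3

/-- The site that holds an edge of the reduction. -/
def gadgetOwner (emb : Option (Fin k') → Fin k) : GadgetEdge k' r d → Fin k
  | Sum.inl (o, _) => emb o
  | Sum.inr _ => emb none

/-- The input graphs of the reduction. -/
def gadgetGraph (emb : Option (Fin k') → Fin k) (ι : GadgetVertex k' r a → Fin n)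
    (ψ : FillerSlot k' r d → Fin a × Fin a) (y : HubInput r (Fin k')) (i : Fin k) :
    SimpleGraph (Fin n) :=
  SimpleGraph.fromEdgeSet (gadgetSym2 ι ψ y '' (gadgetOwner emb ⁻¹' {i}))

variable {emb : Option (Fin k') → Fin k} {ι : GadgetVertex k' r a → Fin n}
  {ψ : FillerSlot k' r d → Fin a × Fin a}

theorem edgeSet_gadgetGraph (hι : Function.Injective ι) (y : HubInput r (Fin k')) (i : Fin k) :
    (gadgetGraph emb ι ψ y i).edgeSet = gadgetSym2 ι ψ y '' (gadgetOwner emb ⁻¹' {i}) := by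
  rw [gadgetGraph, SimpleGraph.edgeSet_fromEdgeSet, sdiff_eq_left, Set.disjoint_left]
  rintro _ ⟨x, _, rfl⟩ h
  exact not_isDiag_gadgetSym2 hι ψ y x (by simpa using h)

theorem edgeSet_unionGraph (hι : Function.Injective ι) (y : HubInput r (Fin k')) :
    (unionGraph (gadgetGraph emb ι ψ y)).edgeSet = Set.range (gadgetSym2 ι ψ y) := by
  ext s
  induction s with
  | _ v w =>
  rw [SimpleGraph.mem_edgeSet, unionGraph, SimpleGraph.iSup_adj]
  simp only [← SimpleGraph.mem_edgeSet, edgeSet_gadgetGraph hι]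
  constructor
  · rintro ⟨i, x, _, hx⟩
    exact ⟨x, hx⟩
  · rintro ⟨x, hx⟩
    exact ⟨_, x, rfl, hx⟩

theorem unionGraph_gadgetGraph_adj (hι : Function.Injective ι) (y : HubInput r (Fin k'))
    (x : GadgetEdge k' r d) : (unionGraph (gadgetGraph emb ι ψ y)).Adj
      (ι (gadgetPair ψ y x).1) (ι (gadgetPair ψ y x).2) := by
  rw [← SimpleGraph.mem_edgeSet, edgeSet_unionGraph hι]
  exact ⟨x, rfl⟩

theorem gadgetGraph_mem_inputsExactly (hι : Function.Injective ι) (hψ : Function.Injective ψ)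
    (y : HubInput r (Fin k')) :
    gadgetGraph emb ι ψ y ∈ inputsExactly n ((k' + 1) * r + (k' + d)) k := by
  refine ⟨fun i j hij => ?_, ?_⟩
  · rw [edgeSet_gadgetGraph hι, edgeSet_gadgetGraph hι,
      Set.disjoint_image_iff (gadgetSym2_injective hι hψ y)]
    exact Disjoint.preimage _ (by simpa using hij)
  · rw [edgeSet_unionGraph hι, ← Set.image_univ,
      Set.ncard_image_of_injective _ (gadgetSym2_injective hι hψ y), Set.ncard_univ]
    simp [Nat.card_eq_fintype_card]

theorem gadgetGraph_congr {y y' : HubInput r (Fin k')} {i : Fin k}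
    (h : ∀ o, emb o = i → hubBit y o = hubBit y' o) :
    gadgetGraph emb ι ψ y i = gadgetGraph emb ι ψ y' i := by
  unfold gadgetGraph
  congr 1
  refine Set.image_congr fun x hx => ?_
  have : gadgetPair ψ y x = gadgetPair ψ y' x := by
    rcases x with ⟨o, e⟩ | x
    · simp only [gadgetPair, h o hx]
    · rcases x with j | t <;> rfl
  rw [gadgetSym2, gadgetSym2, this]

/-- The graph of site `some j` depends only on its own set, so the remaining sets on the right are
arbitrary placeholders. -/
theorem gadgetGraph_update (hemb : Function.Injective emb) (U : Fin r → Bool)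
    (S : Fin k' → Fin r → Bool) (j : Fin k') (A : Fin r → Bool) :
    gadgetGraph emb ι ψ (U, Function.update S j A) =
      Function.update (gadgetGraph emb ι ψ (U, S)) (emb (some j))
        (gadgetGraph emb ι ψ (fun _ => false, fun _ => A) (emb (some j))) := by
  ext1 i
  by_cases hi : i = emb (some j)
  · subst hi
    rw [Function.update_self]
    refine gadgetGraph_congr fun o ho => ?_
    rw [hemb ho]
    simp [hubBit]
  · rw [Function.update_of_ne hi]
    refine gadgetGraph_congr fun o ho => ?_
    rcases o with _ | l
    · rfl
    · have : l ≠ j := by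
        rintro rfl
        exact hi ho.symm
      simp [hubBit, this]

/-- The colouring of the reduction for pairwise disjoint sets. -/
def gadgetColor (U : Fin r → Bool) : GadgetVertex k' r a → Bool
  | Sum.inl none => false
  | Sum.inl (some _) => true
  | Sum.inr (Sum.inl e) => U e
  | Sum.inr (Sum.inr (Sum.inl _)) => false
  | Sum.inr (Sum.inr (Sum.inr _)) => true

theorem bipartiteness_gadgetGraph (hι : Function.Injective ι) (U : Fin r → Bool)
    (S : Fin k' → Fin r → Bool) :
    Bipartiteness (gadgetGraph emb ι ψ (U, S)) ↔
      ∀ j e, ¬ (S j e = true ∧ U e = true) := by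
  constructor
  · rintro ⟨C⟩ j e ⟨hS, hU⟩
    have h1 := C.valid (unionGraph_gadgetGraph_adj (emb := emb) (ψ := ψ) hι (U, S)
      (Sum.inl (none, e)))
    have h2 := C.valid (unionGraph_gadgetGraph_adj (emb := emb) (ψ := ψ) hι (U, S)
      (Sum.inl (some j, e)))
    have h3 := C.valid (unionGraph_gadgetGraph_adj (emb := emb) (ψ := ψ) hι (U, S)
      (Sum.inr (Sum.inl j)))
    simp only [gadgetPair, hubBit, hS, hU, if_true] at h1 h2 h3
    -- The hub, the site and the element would need three distinct colours in `Fin 2`.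
    omega
  · intro h
    -- An element of `U` is coloured against the hub, any other against the sites. Vertices outside
    -- the range of `ι` are isolated, so their default colour is harmless.
    have hval : ∀ v w, (unionGraph (gadgetGraph emb ι ψ (U, S))).Adj v w →
        Function.extend ι (gadgetColor U) (fun _ => false) v ≠
          Function.extend ι (gadgetColor U) (fun _ => false) w := by
      intro v w hvw
      rw [← SimpleGraph.mem_edgeSet, edgeSet_unionGraph hι] at hvw
      obtain ⟨x, hx⟩ := hvw
      have hcol : gadgetColor U (gadgetPair ψ (U, S) x).1 ≠
          gadgetColor U (gadgetPair ψ (U, S) x).2 := by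
        rcases x with ⟨_ | j, e⟩ | j | t
        · by_cases hb : U e = true <;> simp [gadgetPair, hubBit, hb, gadgetColor, fillerPair]
        · have := h j e
          by_cases hb : S j e = true
          · simp only [hb, true_and, Bool.not_eq_true] at this
            simp [gadgetPair, hubBit, hb, gadgetColor, this]
          · simp [gadgetPair, hubBit, hb, gadgetColor, fillerPair]
        · simp [gadgetPair, gadgetColor]
        · simp [gadgetPair, gadgetColor, fillerPair]
      rcases Sym2.eq_iff.1 hx with ⟨rfl, rfl⟩ | ⟨rfl, rfl⟩
      · rwa [hι.extend_apply, hι.extend_apply]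
      · rw [hι.extend_apply, hι.extend_apply]
        exact hcol.symm
    have := (SimpleGraph.Coloring.mk _ fun {v w} => hval v w).colorable
    rwa [Fintype.card_bool] at this

end Gadget

/-- The communication lower bound from the reduction with `k'` sites, `r` elements and filler
edges between two sides of size `a`. -/
theorem card_mul_le_randomized_bits {n m k k' r a b : ℕ} (hk' : 1 ≤ k') (hk'k : k' + 1 ≤ k)
    (hr : 40000 ≤ r) (hn : k' + 1 + r + 2 * a ≤ n) (hm : (k' + 1) * r + k' ≤ m)
    (ha : m ≤ a * a) {T : Type} [MeasurableSpace T] (μ : MeasureTheory.Measure (Fin k → T))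
    [MeasureTheory.IsProbabilityMeasure μ] (P : Protocol k (SimpleGraph (Fin n)) T)
    (hcost : P.CostAtMost (inputsExactly n m k) b)
    (herr : P.ComputesWithError μ (inputsExactly n m k) Bipartiteness (1 / 3)) :
    (k' : ℝ) * r ≤ 15000 * (Real.log (8 * (k : ℝ) ^ 2) * b) := by
  obtain ⟨d, rfl⟩ := Nat.exists_eq_add_of_le hm
  obtain ⟨emb⟩ : Nonempty (Option (Fin k') ↪ Fin k) :=
    Function.Embedding.nonempty_of_card_le (by simpa using hk'k)
  obtain ⟨ι⟩ : Nonempty (GadgetVertex k' r a ↪ Fin n) :=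
    Function.Embedding.nonempty_of_card_le (by
      simp only [Fintype.card_sum, Fintype.card_option, Fintype.card_fin]
      omega)
  obtain ⟨ψ⟩ : Nonempty (FillerSlot k' r d ↪ Fin a × Fin a) :=
    Function.Embedding.nonempty_of_card_le (by
      simp only [Fintype.card_sum, Fintype.card_prod, Fintype.card_option, Fintype.card_fin]
      omega)
  have : Nonempty (Fin k') := ⟨⟨0, hk'⟩⟩
  have h := P.card_mul_le_of_disjointness μ hcost herr (by omega) hr
    (Function.Embedding.some.trans emb) (gadgetGraph emb ι ψ)
    (fun j A => gadgetGraph emb ι ψ (fun _ => false, fun _ => A) (emb (some j)))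
    (fun U S j A => gadgetGraph_update emb.injective U S j A)
    (fun y => by
      rw [add_assoc]
      exact gadgetGraph_mem_inputsExactly ι.injective ψ.injective y)
    (bipartiteness_gadgetGraph ι.injective)
  simpa using h

end MessagePassing

/-! ### Choice of the parameters. -/

namespace MessagePassing

theorem randomizedCC_mono {k : ℕ} {X : Type} {ε : ℝ≥0∞} {dom dom' : Set (Fin k → X)}
    (h : dom ⊆ dom') (f : (Fin k → X) → Prop) :
    randomizedCC ε dom f ≤ randomizedCC ε dom' f := by
  refine le_iInf₂ fun b hb => ?_
  obtain ⟨T, hT, μ, hμ, P, hcost, herr⟩ := hb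
  exact iInf₂_le b ⟨T, hT, μ, hμ, P, fun x hx => hcost x (h hx), fun x hx => herr x (h hx)⟩

theorem inputsExactly_subset_inputsAtMost {n m m' k : ℕ} (h : m' ≤ m) :
    inputsExactly n m' k ⊆ inputsAtMost n m k := fun _ hG => ⟨hG.1, hG.2.le.trans h⟩

theorem log_eight_mul_sq_le {k : ℕ} (hk : 2 ≤ k) :
    Real.log (8 * (k : ℝ) ^ 2) ≤ 5 * Real.log k := by
  have hk' : (2 : ℝ) ≤ k := by exact_mod_cast hk
  have h8 : (8 : ℝ) ≤ k ^ 3 := by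
    calc (8 : ℝ) = 2 ^ 3 := by norm_num
      _ ≤ _ := by gcongr
  have h : Real.log (8 * (k : ℝ) ^ 2) ≤ Real.log ((k : ℝ) ^ 5) := by
    apply Real.log_le_log (by positivity)
    calc (8 : ℝ) * (k : ℝ) ^ 2 ≤ (k : ℝ) ^ 3 * (k : ℝ) ^ 2 := by gcongr
      _ = (k : ℝ) ^ 5 := by ring
  rw [Real.log_pow] at h
  exact_mod_cast h

/-- The lower bound for a given number of edges and sufficiently many sites. -/
theorem le_randomizedCC_inputsExactly {δ : ℝ} (hδ : 0 < δ) {n m k : ℕ} (hk2 : 2 ≤ k)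
    (hk : 400000 / δ ≤ k) (hkn : k ≤ n) (hnm : n ≤ m)
    (hm : (m : ℝ) ≤ (1 / 4 - δ) * (n : ℝ) ^ 2) :
    ENNReal.ofReal (δ ^ 2 / 120000000000 *
        (k * min (n : ℝ) ((m : ℝ) / k) / Real.log k)) ≤
      randomizedCC (1 / 3) (inputsExactly n m k) Bipartiteness := by
  have hk2' : (2 : ℝ) ≤ k := by exact_mod_cast hk2
  have hkn' : (k : ℝ) ≤ n := by exact_mod_cast hkn
  have hnm' : (n : ℝ) ≤ m := by exact_mod_cast hnm
  have hδ4 : δ < 1 / 4 := by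
    by_contra hcon
    push Not at hcon
    have : (1 / 4 - δ) * (n : ℝ) ^ 2 ≤ 0 :=
      mul_nonpos_of_nonpos_of_nonneg (by linarith) (by positivity)
    linarith
  have hδk : 400000 ≤ δ * k := by
    rw [div_le_iff₀ hδ] at hk
    linarith
  have hδn : 400000 ≤ δ * n := hδk.trans (mul_le_mul_of_nonneg_left hkn' hδ.le)
  set ρ : ℝ := min (n : ℝ) ((m : ℝ) / k) with hρ
  have hρ1 : 1 ≤ ρ := le_min (by linarith) (by rw [le_div_iff₀ (by linarith)]; linarith)
  have hρn : ρ ≤ n := min_le_left _ _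
  have hρm : k * ρ ≤ m := by
    have : ρ ≤ m / k := min_le_right _ _
    rw [le_div_iff₀ (by linarith)] at this
    linarith
  -- The argument of this floor is at least 2, so rounding loses at most half. The factor 1/200000
  -- keeps the gadget within kρ ≤ m edges although its 40000 + s elements may be as many as 40001ρ.
  set k' := ⌊δ / 200000 * k⌋₊ with hk'
  set s := ⌊δ / 4 * ρ⌋₊ with hs
  -- The filler sides leave about δn vertices for the gadget, while a², about (1-δ)²n²/4, still
  -- exceeds (1/4-δ)n².
  set a := ⌊(1 - δ) * n / 2⌋₊ with ha
  have hk'le : (k' : ℝ) ≤ δ / 200000 * k := Nat.floor_le (by positivity)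
  have hk'ge : δ / 400000 * k ≤ k' := by
    have := Nat.lt_floor_add_one (δ / 200000 * k)
    linarith
  have hk'1 : (1 : ℝ) ≤ k' := by linarith
  have hsle : (s : ℝ) ≤ δ / 4 * ρ := Nat.floor_le (by positivity)
  have hsge : δ / 4 * ρ < s + 1 := Nat.lt_floor_add_one _
  have hale : (a : ℝ) ≤ (1 - δ) * n / 2 :=
    Nat.floor_le (div_nonneg (mul_nonneg (by linarith) (Nat.cast_nonneg _)) zero_le_two)
  have hage : (1 - δ) * n / 2 < a + 1 := Nat.lt_floor_add_one _
  have hδkn : δ * k ≤ δ * n := mul_le_mul_of_nonneg_left hkn' hδ.le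
  have hδρn : δ * ρ ≤ δ * n := mul_le_mul_of_nonneg_left hρn hδ.le
  have hδ4k : δ * k ≤ 1 / 4 * k := mul_le_mul_of_nonneg_right hδ4.le (by linarith)
  have c1 : k' + 1 ≤ k := by
    have : (k' : ℝ) + 1 ≤ k := by linarith
    exact_mod_cast this
  have c2 : k' + 1 + (40000 + s) + 2 * a ≤ n := by
    have : (k' : ℝ) + 1 + (40000 + s) + 2 * a ≤ n := by linarith
    exact_mod_cast this
  have c3 : (k' + 1) * (40000 + s) + k' ≤ m := by
    have h1 : ((k' : ℝ) + 1) * (40000 + s) + k' ≤ m := by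
      have hs0 : (0 : ℝ) ≤ s := Nat.cast_nonneg _
      have e1 : ((k' : ℝ) + 1) * (40000 + s) + k' ≤ 3 * (k' * (40000 + s)) := by
        have f1 : 1 * (40000 + (s : ℝ)) ≤ k' * (40000 + s) :=
          mul_le_mul_of_nonneg_right hk'1 (by positivity)
        have f2 : (k' : ℝ) * 1 ≤ k' * (40000 + s) :=
          mul_le_mul_of_nonneg_left (by linarith) (by positivity)
        linarith
      have e2 : (40000 : ℝ) + s ≤ 40001 * ρ := by
        have : δ * ρ ≤ 1 / 4 * ρ := mul_le_mul_of_nonneg_right hδ4.le (by linarith)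
        linarith
      have e3 : (k' : ℝ) * (40000 + s) ≤ (δ / 200000 * k) * (40001 * ρ) :=
        mul_le_mul hk'le e2 (by positivity) (by positivity)
      have e4 : δ * (k * ρ) ≤ 1 / 4 * (k * ρ) :=
        mul_le_mul_of_nonneg_right hδ4.le (by positivity)
      have e5 : 0 ≤ (k : ℝ) * ρ := by positivity
      have e6 : (δ / 200000 * k) * (40001 * ρ) = 40001 / 200000 * (δ * (k * ρ)) := by ring
      linarith
    exact_mod_cast h1
  have c4 : m ≤ a * a := by
    have h1 : (m : ℝ) ≤ a * a := by
      have e0 : (0 : ℝ) ≤ (1 - δ) * n / 2 - 1 := by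
        have : δ * n ≤ 1 / 4 * n := mul_le_mul_of_nonneg_right hδ4.le (by linarith)
        linarith
      have e1 : (1 - δ) * n / 2 - 1 ≤ a := by linarith
      have e2 : ((1 - δ) * n / 2 - 1) * ((1 - δ) * n / 2 - 1) ≤ a * a :=
        mul_self_le_mul_self e0 e1
      have e3 : 400000 * (n : ℝ) ≤ δ * n * n :=
        mul_le_mul_of_nonneg_right hδn (Nat.cast_nonneg _)
      have e4 : 0 ≤ (δ * n) ^ 2 := sq_nonneg _
      have e5 : ((1 - δ) * n / 2 - 1) * ((1 - δ) * n / 2 - 1) =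
          (n : ℝ) ^ 2 / 4 - δ * n * n / 2 + (δ * n) ^ 2 / 4 - n + δ * n + 1 := by ring
      have e6 : (1 / 4 - δ) * (n : ℝ) ^ 2 = (n : ℝ) ^ 2 / 4 - δ * n * n := by ring
      linarith
    exact_mod_cast h1
  have hlog : 0 < Real.log k := Real.log_pos (by linarith)
  refine le_iInf₂ fun b hb => ?_
  obtain ⟨T, hT, μ, hμ, P, hcost, herr⟩ := hb
  have hmain := card_mul_le_randomized_bits (by exact_mod_cast hk'1) c1
    (Nat.le_add_right 40000 s) c2 c3 c4 μ P hcost herr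
  have h1 : (δ / 400000 * k) * (δ / 4 * ρ) ≤ k' * ((40000 + s : ℕ) : ℝ) := by
    refine mul_le_mul hk'ge ?_ (by positivity) (by positivity)
    push_cast
    linarith
  have h2 : Real.log (8 * (k : ℝ) ^ 2) * b ≤ 5 * Real.log k * b :=
    mul_le_mul_of_nonneg_right (log_eight_mul_sq_le hk2) (Nat.cast_nonneg _)
  refine (ENNReal.ofReal_le_ofReal ?_).trans_eq (ENNReal.ofReal_natCast b)
  rw [← mul_div_assoc, div_le_iff₀ hlog]
  -- The final constant is 120000000000 = 1600000 · 15000 · 5.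
  have h3 : (δ / 400000 * k) * (δ / 4 * ρ) = δ ^ 2 / 1600000 * (k * ρ) := by ring
  linarith

/-- Here log n ≥ log 2 > 1/2. -/
theorem half_mul_le_of_mul_log_le {C : ℝ} (hC : 0 < C) {n k : ℕ} (hn : 2 ≤ n)
    (h : C * Real.log n ≤ k) : C / 2 ≤ k := by
  have hn' : (2 : ℝ) ≤ n := by exact_mod_cast hn
  have h1 : Real.log 2 ≤ Real.log n := Real.log_le_log two_pos hn'
  have h2 := Real.log_two_gt_d9
  nlinarith

theorem le_randomizedCC_inputsAtMost {n m k : ℕ} (hk : 3200000 ≤ k) (hkn : k ≤ n) (hnm : n ≤ m) :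
    ENNReal.ofReal ((1 / 8) ^ 2 / 120000000000 / 16 *
        (k * min (n : ℝ) ((m : ℝ) / k) / Real.log k)) ≤
      randomizedCC (1 / 3) (inputsAtMost n m k) Bipartiteness := by
  have hk' : (3200000 : ℝ) ≤ k := by exact_mod_cast hk
  have hkn' : (k : ℝ) ≤ n := by exact_mod_cast hkn
  -- Capping the number of edges meets the density condition of the exact bound with δ = 1/8.
  set m₀ := min m (n ^ 2 / 8) with hm₀
  have hn8 : n ≤ n ^ 2 / 8 := by
    rw [Nat.le_div_iff_mul_le (by norm_num), sq]
    exact Nat.mul_le_mul_left n (by omega)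
  have hdiv : ((n ^ 2 / 8 : ℕ) : ℝ) ≤ (n : ℝ) ^ 2 / 8 := by
    exact_mod_cast Nat.cast_div_le (α := ℝ) (m := n ^ 2) (n := 8)
  have hdiv' : (n : ℝ) * n / 16 ≤ ((n ^ 2 / 8 : ℕ) : ℝ) := by
    have h1 : n ^ 2 < (n ^ 2 / 8 + 1) * 8 := Nat.lt_mul_of_div_lt (Nat.lt_succ_self _) (by norm_num)
    have h2 : (n : ℝ) ^ 2 < (((n ^ 2 / 8 : ℕ) : ℝ) + 1) * 8 := by exact_mod_cast h1
    nlinarith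
  have hm₀le : (m₀ : ℝ) ≤ (1 / 4 - 1 / 8) * (n : ℝ) ^ 2 := by
    have : (m₀ : ℝ) ≤ ((n ^ 2 / 8 : ℕ) : ℝ) := by exact_mod_cast min_le_right _ _
    linarith
  have h := le_randomizedCC_inputsExactly (δ := 1 / 8) (by norm_num) (by omega)
    (by linarith) hkn (le_min hnm hn8) hm₀le
  refine (ENNReal.ofReal_le_ofReal ?_).trans
    (h.trans (randomizedCC_mono (inputsExactly_subset_inputsAtMost (min_le_left _ _)) _))
  have hlog : 0 < Real.log k := Real.log_pos (by linarith)
  -- If the cap is active, m₀ ≥ n²/16 after rounding, so m₀/k ≥ n/16 because k ≤ n.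
  have hmin : min (n : ℝ) ((m : ℝ) / k) ≤ 16 * min (n : ℝ) ((m₀ : ℝ) / k) := by
    have hn0 : (0 : ℝ) ≤ n := Nat.cast_nonneg _
    have hk0 : (0 : ℝ) < k := by linarith
    rw [mul_min_of_nonneg _ _ (by norm_num : (0 : ℝ) ≤ 16)]
    refine le_min ((min_le_left _ _).trans (by linarith)) ?_
    rcases le_total m (n ^ 2 / 8) with hc | hc
    · rw [hm₀, min_eq_left hc]
      have : 0 ≤ (m : ℝ) / k := by positivity
      exact (min_le_right _ _).trans (by linarith)
    · rw [hm₀, min_eq_right hc]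
      refine (min_le_left _ _).trans ?_
      rw [← mul_div_assoc, le_div_iff₀ hk0]
      nlinarith
  rw [div_mul_eq_mul_div _ (16 : ℝ), div_le_iff₀ (by norm_num : (0 : ℝ) < 16), mul_assoc]
  refine mul_le_mul_of_nonneg_left ?_ (by positivity)
  rw [div_mul_eq_mul_div, div_le_div_iff_of_pos_right hlog, mul_assoc]
  refine mul_le_mul_of_nonneg_left ?_ (by positivity)
  linarith

end MessagePassing

theorem mainTheorem7 :
    (∃ C : ℝ, 0 < C ∧ ∃ c : ℝ, 0 < c ∧ ∀ n m k : ℕ,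
      2 ≤ k → C * Real.log n ≤ k → k ≤ min n m → n ≤ m →
        ENNReal.ofReal (c * (k * min (n : ℝ) ((m : ℝ) / k) / Real.log k)) ≤
          MessagePassing.randomizedCC (1 / 3) (MessagePassing.inputsAtMost n m k)
            MessagePassing.Bipartiteness) ∧
    (∀ δ : ℝ, 0 < δ → ∃ C : ℝ, 0 < C ∧ ∃ c : ℝ, 0 < c ∧ ∀ n m k : ℕ,
      2 ≤ k → C * Real.log n ≤ k → k ≤ min n m → n ≤ m →
      (m : ℝ) ≤ (1 / 4 - δ) * (n : ℝ) ^ 2 →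
        ENNReal.ofReal (c * (k * min (n : ℝ) ((m : ℝ) / k) / Real.log k)) ≤
          MessagePassing.randomizedCC (1 / 3) (MessagePassing.inputsExactly n m k)
            MessagePassing.Bipartiteness) := by
  constructor
  · refine ⟨6400000, by norm_num, (1 / 8) ^ 2 / 120000000000 / 16, by norm_num, ?_⟩
    intro n m k hk2 hC hkn hnm
    have hkn' := hkn.trans (min_le_left _ _)
    have h := MessagePassing.half_mul_le_of_mul_log_le (by norm_num) (hk2.trans hkn') hC
    have h' : (3200000 : ℝ) ≤ k := by linarith
    exact MessagePassing.le_randomizedCC_inputsAtMost (by exact_mod_cast h') hkn' hnm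
  · intro δ hδ
    refine ⟨800000 / δ, by positivity, δ ^ 2 / 120000000000, by positivity, ?_⟩
    intro n m k hk2 hC hkn hnm hm
    have hkn' := hkn.trans (min_le_left _ _)
    have h := MessagePassing.half_mul_le_of_mul_log_le (by positivity) (hk2.trans hkn') hC
    refine MessagePassing.le_randomizedCC_inputsExactly hδ hk2 (le_trans (le_of_eq ?_) h)
      hkn' hnm hm
    ring
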